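/- Let $\mathbb N^\times$ be the category with one object whose endomorphism monoid is the multiplicative monoid of positive integers, and let $\widehat{\mathbb N^\times}$ be the topos of presheaves of sets on it. The arithmetic site is this topos with the structure sheaf $\mathcal O=\overline{\mathbb N}=(\mathbb N\cup\{\infty\},\min,+)$, on which $n\in\mathbb N^\times$ acts by multiplication by $n$. A point of the arithmetic site over a local semiring $R$ is a pair $(p,f)$ of a point $p$ of the topos $\widehat{\mathbb N^\times}$ (a geometric morphism from the topos of sets) and a local morphism of semirings $f:\mathcal O_p\to R$ from the stalk of $\mathcal O$ at $p$; two such pairs $(p,f)$, $(p',f')$ are identified if there is an isomorphism $p\simeq p'$ that carries $f'$ to $f$. Let $[0,1]_{\max}=([0,1],\max,\times)$, the maximal compact subring of the tropical semifield $\mathbb R_+^{\max}=([0,\infty),\max,\times)$, and for $\lambda>0$ let $\mathrm{Fr}_\lambda\in\mathrm{Aut}([0,1]_{\max})$ be the Frobenius automorphism $x\mapsto x^\lambda$; it acts on points over $[0,1]_{\max}$ by $(p,f)\mapsto(p,\mathrm{Fr}_\lambda\circ f)$. Let $\mathbb A_{\mathbb Q}=\mathbb R\times\mathbb A_f$ be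 the ring of adèles of $\mathbb Q$. For $a\in\mathbb A_f$ put $H_a=\{q\in\mathbb Q: qa\in\hat{\mathbb Z}\}$, an ordered subgroup of $\mathbb Q$, and let $\mathcal O(H_a)=(\{h\in H_a: h\ge 0\}\cup\{\infty\},\min,+)$. Theorem. There is a bijection $\Phi$ from the set of points of the arithmetic site over $[0,1]_{\max}$ to the double quotient $\mathbb Q^\times\backslash\mathbb A_{\mathbb Q}/\hat{\mathbb Z}^*$ that is characterized as follows: $\Phi(p,f)$ is the class of $(r,a)\in\mathbb R\times\mathbb A_f$ if and only if there is an isomorphism of semirings $e:\mathcal O(H_a)\simeq\mathcal O_p$ such that $f(e(\infty))=0$ and, for all $h\ge0$ in $H_a$, $f(e(h))=\exp(-|r|h)$ if $r\neq0$, while if $r=0$ then $f(e(0))=1$ and $f(e(h))=0$ for $h>0$. The map that sends $\lambda>0$ to the class of the idèle with archimedean component $\lambda$ and all other components $1$ is an isomorphism $\theta$ from $\mathbb R_+^*$ to the idèle class group of $\mathbb Q$ modulo $\hat{\mathbb Z}^*$, and $\Phi(\mathrm{Fr}_\lambda\cdot x)=\theta(\lambda)\cdot\Phi(x)$ for all $\lambda>0$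 and all points $x$, where the idèle class group modulo $\hat{\mathbb Z}^*$ acts on the double quotient by multiplication. -/

import Mathlib

open CategoryTheory CategoryTheory.Limits Opposite
open scoped NNReal

noncomputable section

namespace ArithSite

/-! ## Geometric morphisms and points of a topos -/

/-- A geometric morphism `E ⟶ F`: an inverse image functor `F ⥤ E` that preserves finite limits,
together with a right adjoint, the direct image functor `E ⥤ F`. -/
structure GeomMorphism (E : Type*) [Category E] (F : Type*) [Category F] where
  inverseImage : F ⥤ E
  directImage : E ⥤ F
  adj : inverseImage ⊣ directImage
  preservesFiniteLimits : PreservesFiniteLimits inverseImage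

/-- A point of the topos of presheaves of sets on `C`: a geometric morphism from the topos of
sets to it. -/
abbrev ToposPoint (C : Type) [SmallCategory C] := GeomMorphism Type (Cᵒᵖ ⥤ Type)

/-! ## The semiring structure on stalks

A presheaf `S` of commutative semirings on `C` is a commutative semiring in the topos of presheaves
of sets on `C`. Its inverse image at a point `p` is a commutative semiring, since inverse image
functors preserve finite products. -/

section Stalk

open MonoidalCategory CartesianMonoidalCategory

variable {C : Type} [SmallCategory C]

/-- The presheaf of sets underlying a presheaf of commutative semirings. -/
abbrev under (S : Cᵒᵖ ⥤ CommSemiRingCat.{0}) : Cᵒᵖ ⥤ Type :=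
  S ⋙ CategoryTheory.forget CommSemiRingCat.{0}

variable (S : Cᵒᵖ ⥤ CommSemiRingCat.{0})

/-- Addition, as a morphism of presheaves of sets. -/
def addHom : under S ⊗ under S ⟶ under S where
  app U := TypeCat.ofHom fun x : S.obj U × S.obj U => x.1 + x.2
  naturality U V f := by
    ext x
    exact (map_add (S.map f).hom x.1 x.2).symm

/-- Multiplication, as a morphism of presheaves of sets. -/
def mulHom : under S ⊗ under S ⟶ under S where
  app U := TypeCat.ofHom fun x : S.obj U × S.obj U => x.1 * x.2
  naturality U V f := by
    ext x
    exact (map_mul (S.map f).hom x.1 x.2).symm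

/-- The zero section, as a morphism of presheaves of sets. -/
def zeroHom : 𝟙_ (Cᵒᵖ ⥤ Type) ⟶ under S where
  app U := TypeCat.ofHom fun _ => (0 : S.obj U)
  naturality U V f := by
    ext x
    exact (map_zero (S.map f).hom).symm

/-- The unit section, as a morphism of presheaves of sets. -/
def oneHom : 𝟙_ (Cᵒᵖ ⥤ Type) ⟶ under S where
  app U := TypeCat.ofHom fun _ => (1 : S.obj U)
  naturality U V f := by
    ext x
    exact (map_one (S.map f).hom).symm

variable (p : ToposPoint C)

instance : PreservesFiniteLimits p.inverseImage := p.preservesFiniteLimits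

/-- The stalk of `S` at the point `p`. -/
def Stalk : Type := p.inverseImage.obj (under S)

/-- The canonical bijection between `p^*(X) × p^*(Y)` and `p^*(X × Y)`. -/
def tuple {X Y : Cᵒᵖ ⥤ Type} (x : p.inverseImage.obj X) (y : p.inverseImage.obj Y) :
    p.inverseImage.obj (X ⊗ Y) :=
  (prodComparisonIso p.inverseImage X Y).inv (show _ × _ from (x, y))

/-- The unique element of `p^*(1)`. -/
def pt : p.inverseImage.obj (𝟙_ (Cᵒᵖ ⥤ Type)) :=
  inv (CartesianMonoidalCategory.terminalComparison p.inverseImage) PUnit.unit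

lemma prodComparison_tuple {X Y : Cᵒᵖ ⥤ Type} (x : p.inverseImage.obj X)
    (y : p.inverseImage.obj Y) :
    CartesianMonoidalCategory.prodComparison p.inverseImage X Y (tuple p x y) =
      ((x, y) : p.inverseImage.obj X × p.inverseImage.obj Y) := by
  have h := (prodComparisonIso p.inverseImage X Y).inv_hom_id
  exact ConcreteCategory.congr_hom (C := Type) h
    ((x, y) : p.inverseImage.obj X × p.inverseImage.obj Y)

lemma tuple_prodComparison {X Y : Cᵒᵖ ⥤ Type} (z : p.inverseImage.obj (X ⊗ Y)) :
    tuple p (p.inverseImage.map (fst X Y) z) (p.inverseImage.map (snd X Y) z) = z := by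
  have h := (prodComparisonIso p.inverseImage X Y).hom_inv_id
  exact ConcreteCategory.congr_hom h z

lemma map_fst_tuple {X Y : Cᵒᵖ ⥤ Type} (x : p.inverseImage.obj X) (y : p.inverseImage.obj Y) :
    p.inverseImage.map (fst X Y) (tuple p x y) = x :=
  congrArg Prod.fst (prodComparison_tuple p x y)

lemma map_snd_tuple {X Y : Cᵒᵖ ⥤ Type} (x : p.inverseImage.obj X) (y : p.inverseImage.obj Y) :
    p.inverseImage.map (snd X Y) (tuple p x y) = y :=
  congrArg Prod.snd (prodComparison_tuple p x y)

lemma map_comp_app {X Y Z : Cᵒᵖ ⥤ Type} (f : X ⟶ Y) (g : Y ⟶ Z) (x : p.inverseImage.obj X) :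
    p.inverseImage.map g (p.inverseImage.map f x) = p.inverseImage.map (f ≫ g) x := by
  rw [Functor.map_comp]; rfl

lemma tuple_map {W X Y : Cᵒᵖ ⥤ Type} (f : W ⟶ X) (g : W ⟶ Y) (w : p.inverseImage.obj W) :
    tuple p (p.inverseImage.map f w) (p.inverseImage.map g w) = p.inverseImage.map (lift f g) w := by
  rw [← tuple_prodComparison p (p.inverseImage.map (lift f g) w), map_comp_app, map_comp_app,
    lift_fst, lift_snd]

lemma pt_eq_map {W : Cᵒᵖ ⥤ Type} (w : p.inverseImage.obj W) :
    pt p = p.inverseImage.map (toUnit W) w := by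
  have h := (asIso (CartesianMonoidalCategory.terminalComparison p.inverseImage)).hom_inv_id
  exact ConcreteCategory.congr_hom h (p.inverseImage.map (toUnit W) w)

lemma exists_joint (x y z : p.inverseImage.obj (under S)) :
    ∃ (W : Cᵒᵖ ⥤ Type) (w : p.inverseImage.obj W) (f g h : W ⟶ under S),
      x = p.inverseImage.map f w ∧ y = p.inverseImage.map g w ∧ z = p.inverseImage.map h w := by
  refine ⟨under S ⊗ (under S ⊗ under S), tuple p x (tuple p y z), fst _ _, snd _ _ ≫ fst _ _,
    snd _ _ ≫ snd _ _, ?_, ?_, ?_⟩ <;>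
  simp only [← map_comp_app, map_fst_tuple, map_snd_tuple]

namespace Stalk

variable {S p}

instance : Add (Stalk S p) := ⟨fun x y => p.inverseImage.map (addHom S) (tuple p x y)⟩
instance : Mul (Stalk S p) := ⟨fun x y => p.inverseImage.map (mulHom S) (tuple p x y)⟩
instance : Zero (Stalk S p) := ⟨p.inverseImage.map (zeroHom S) (pt p)⟩
instance : One (Stalk S p) := ⟨p.inverseImage.map (oneHom S) (pt p)⟩

/-- The map of stalks induced by a morphism of points (a natural transformation of inverse image
functors). -/
def map {p q : ToposPoint C} (α : p.inverseImage ⟶ q.inverseImage) (s : Stalk S p) : Stalk S q :=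
  α.app (under S) s

/-- The element of the stalk obtained from `f : W ⟶ S` and an element of `p^*(W)`. -/
def ev {W : Cᵒᵖ ⥤ Type} (w : p.inverseImage.obj W) (f : W ⟶ under S) : Stalk S p :=
  p.inverseImage.map f w

variable {W : Cᵒᵖ ⥤ Type} (w : p.inverseImage.obj W) (f g h : W ⟶ under S)

lemma ev_add : ev w f + ev w g = ev w (lift f g ≫ addHom S) :=
  (congrArg _ (tuple_map p f g w)).trans (map_comp_app p _ _ w)

lemma ev_mul : ev w f * ev w g = ev w (lift f g ≫ mulHom S) :=
  (congrArg _ (tuple_map p f g w)).trans (map_comp_app p _ _ w)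

lemma ev_zero : (0 : Stalk S p) = ev w (toUnit W ≫ zeroHom S) :=
  (congrArg _ (pt_eq_map p w)).trans (map_comp_app p _ _ w)

lemma ev_one : (1 : Stalk S p) = ev w (toUnit W ≫ oneHom S) :=
  (congrArg _ (pt_eq_map p w)).trans (map_comp_app p _ _ w)

lemma induct {P : Stalk S p → Stalk S p → Stalk S p → Prop}
    (H : ∀ (W : Cᵒᵖ ⥤ Type) (w : p.inverseImage.obj W) (f g h : W ⟶ under S),
      P (ev w f) (ev w g) (ev w h)) (x y z : Stalk S p) : P x y z := by
  obtain ⟨W, w, f, g, h, rfl, rfl, rfl⟩ := exists_joint S p x y z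
  exact H W w f g h

instance : CommSemiring (Stalk S p) where
  add_assoc := induct fun W w f g h => by
    simp only [ev_add]; congr 1; ext U x; exact add_assoc (G := S.obj U) _ _ _
  zero_add x := induct (P := fun x _ _ => 0 + x = x) (fun W w f g h => by
    simp only [ev_add, ev_zero w]; congr 1; ext U x; exact zero_add (M := S.obj U) _) x x x
  add_zero x := induct (P := fun x _ _ => x + 0 = x) (fun W w f g h => by
    simp only [ev_add, ev_zero w]; congr 1; ext U x; exact add_zero (M := S.obj U) _) x x x
  add_comm x y := induct (P := fun x y _ => x + y = y + x) (fun W w f g h => by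
    simp only [ev_add]; congr 1; ext U x; exact add_comm (G := S.obj U) _ _) x y y
  left_distrib := induct fun W w f g h => by
    simp only [ev_add, ev_mul]; congr 1; ext U x; exact mul_add (R := S.obj U) _ _ _
  right_distrib := induct fun W w f g h => by
    simp only [ev_add, ev_mul]; congr 1; ext U x; exact add_mul (R := S.obj U) _ _ _
  zero_mul x := induct (P := fun x _ _ => 0 * x = 0) (fun W w f g h => by
    simp only [ev_mul, ev_zero w]; congr 1; ext U x
    exact MulZeroClass.zero_mul (M₀ := S.obj U) _) x x x
  mul_zero x := induct (P := fun x _ _ => x * 0 = 0) (fun W w f g h => by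
    simp only [ev_mul, ev_zero w]; congr 1; ext U x
    exact MulZeroClass.mul_zero (M₀ := S.obj U) _) x x x
  mul_assoc := induct fun W w f g h => by
    simp only [ev_mul]; congr 1; ext U x; exact mul_assoc (G := S.obj U) _ _ _
  one_mul x := induct (P := fun x _ _ => 1 * x = x) (fun W w f g h => by
    simp only [ev_mul, ev_one w]; congr 1; ext U x; exact one_mul (M := S.obj U) _) x x x
  mul_one x := induct (P := fun x _ _ => x * 1 = x) (fun W w f g h => by
    simp only [ev_mul, ev_one w]; congr 1; ext U x; exact mul_one (M := S.obj U) _) x x x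
  mul_comm x y := induct (P := fun x y _ => x * y = y * x) (fun W w f g h => by
    simp only [ev_mul]; congr 1; ext U x; exact mul_comm (G := S.obj U) _ _) x y y
  nsmul := nsmulRec
  npow := npowRec

end Stalk

end Stalk

/-! ## The arithmetic site -/

/-- The category with one object whose endomorphism monoid is the multiplicative monoid of
positive integers. -/
abbrev NTimes : Type := SingleObj ℕ+

/-- The semiring `(ℕ ∪ {∞}, min, +)`. -/
abbrev NBar : Type := Tropical (WithTop ℕ)

/-- The action of the positive integer `n` on `(ℕ ∪ {∞}, min, +)` by multiplication. -/
def NBar.act (n : ℕ+) : NBar →+* NBar where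
  toFun x := Tropical.trop ((n : ℕ) • Tropical.untrop x)
  map_zero' := zero_pow (M₀ := NBar) n.ne_zero
  map_one' := one_pow (M := NBar) (n : ℕ)
  map_add' x y := Tropical.add_pow x y (n : ℕ)
  map_mul' x y := mul_pow x y (n : ℕ)

/-- The structure sheaf of the arithmetic site: the semiring `(ℕ ∪ {∞}, min, +)`, on which positive
integers act by multiplication, in the topos of presheaves on `NTimes`. -/
def structureSheaf : NTimesᵒᵖ ⥤ CommSemiRingCat.{0} where
  obj _ := CommSemiRingCat.of NBar
  map f := CommSemiRingCat.ofHom (NBar.act (show ℕ+ from f.unop))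
  map_id X := by
    ext x
    exact pow_one (M := NBar) x
  map_comp f g := by
    ext x
    exact pow_mul (M := NBar) x _ _

/-- The stalk of the structure sheaf at a point of the topos. -/
abbrev LocalSemiring (p : ToposPoint NTimes) : Type := Stalk structureSheaf p

/-- A point of the arithmetic site over a local semiring `R`: a point `p` of the topos together with
a local morphism of semirings from the stalk of the structure sheaf at `p` to `R`. -/
structure Point (R : Type) [CommSemiring R] [IsLocalRing R] where
  base : ToposPoint NTimes
  hom : LocalSemiring base →+* R
  isLocal : IsLocalHom hom

/-- Two points over `R` are isomorphic if there is an isomorphism of the underlying points of the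
topos (a natural isomorphism of inverse image functors) that is compatible with the morphisms from
the stalks to `R`. -/
def Point.Iso {R : Type} [CommSemiring R] [IsLocalRing R] (P Q : Point R) : Prop :=
  ∃ α : P.base.inverseImage ≅ Q.base.inverseImage,
    ∀ s : LocalSemiring P.base, Q.hom (Stalk.map α.hom s) = P.hom s

instance Point.setoid (R : Type) [CommSemiring R] [IsLocalRing R] : Setoid (Point R) where
  r := Point.Iso
  iseqv :=
    { refl := fun P => ⟨Iso.refl _, fun _ => rfl⟩
      symm := by
        rintro P Q ⟨α, h⟩
        refine ⟨α.symm, fun s => ?_⟩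
        refine (h _).symm.trans ?_
        exact congrArg Q.hom
          (ConcreteCategory.congr_hom (α.inv_hom_id_app (under structureSheaf)) s)
      trans := by
        rintro P Q T ⟨α, h⟩ ⟨β, k⟩
        exact ⟨α ≪≫ β, fun s => (k (Stalk.map α.hom s)).trans (h s)⟩ }

/-- The set of points of the arithmetic site over `R`, up to isomorphism. -/
def Points (R : Type) [CommSemiring R] [IsLocalRing R] : Type 1 := Quotient (Point.setoid R)

section Action

variable {R : Type} [CommSemiring R] [IsLocalRing R]

/-- Composition of a point over `R` with an automorphism of `R`. -/
def Point.comp (σ : RingAut R) (P : Point R) : Point R where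
  base := P.base
  hom := (RingEquiv.toRingHom σ).comp P.hom
  isLocal := ⟨fun a ha => P.isLocal.map_nonunit a
    ((MulEquiv.isUnit_map (RingEquiv.toMulEquiv σ)).1 ha)⟩

/-- Automorphisms of `R` act on points over `R` by composition. -/
instance : MulAction (RingAut R) (Points R) where
  smul σ := Quotient.map (Point.comp σ) (by
    rintro P Q ⟨α, h⟩
    exact ⟨α, fun s => congrArg σ (h s)⟩)
  one_smul x := by
    obtain ⟨P, rfl⟩ := Quotient.exists_rep x
    rfl
  mul_smul σ τ x := by
    obtain ⟨P, rfl⟩ := Quotient.exists_rep x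
    rfl

end Action

/-! ## The tropical semifield and its maximal compact subring -/

/-- The tropical semifield: nonnegative reals with `max` as addition and the usual product. -/
def RMax : Type := ℝ≥0

namespace RMax

/-- The element of the tropical semifield given by a nonnegative real number. -/
def of (x : ℝ≥0) : RMax := x

/-- The nonnegative real number underlying an element of the tropical semifield. -/
def val (x : RMax) : ℝ≥0 := x

instance : Add RMax := ⟨fun x y => of (max x.val y.val)⟩
instance : Mul RMax := ⟨fun x y => of (x.val * y.val)⟩
instance : Zero RMax := ⟨of 0⟩
instance : One RMax := ⟨of 1⟩

instance : CommSemiring RMax where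
  add_assoc x y z := max_assoc x.val y.val z.val
  zero_add x := max_eq_right (zero_le (a := x.val))
  add_zero x := max_eq_left (zero_le (a := x.val))
  add_comm x y := max_comm x.val y.val
  left_distrib x y z := mul_max x.val y.val z.val
  right_distrib x y z := max_mul x.val y.val z.val
  zero_mul x := MulZeroClass.zero_mul x.val
  mul_zero x := MulZeroClass.mul_zero x.val
  mul_assoc x y z := mul_assoc x.val y.val z.val
  one_mul x := one_mul x.val
  mul_one x := mul_one x.val
  mul_comm x y := mul_comm x.val y.val
  nsmul := nsmulRec
  npow := npowRec

/-- The automorphism `x ↦ x ^ t` of the tropical semifield, for `t > 0`. -/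
def frob (t : {t : ℝ // 0 < t}) : RMax ≃+* RMax where
  toFun x := of (x.val ^ t.1)
  invFun x := of (x.val ^ (t.1)⁻¹)
  left_inv x := NNReal.rpow_rpow_inv t.2.ne' x.val
  right_inv x := NNReal.rpow_inv_rpow t.2.ne' x.val
  map_mul' _ _ := NNReal.mul_rpow
  map_add' _ _ := (NNReal.monotone_rpow_of_nonneg t.2.le).map_max

end RMax

/-- The subring `[0, 1]` of the tropical semifield. -/
def unitSubsemiring : Subsemiring RMax where
  carrier := {x | x.val ≤ 1}
  mul_mem' {x y} hx hy := mul_le_one' (show x.val ≤ 1 from hx) (show y.val ≤ 1 from hy)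
  one_mem' := le_refl (1 : ℝ≥0)
  add_mem' {x y} hx hy := max_le (show x.val ≤ 1 from hx) (show y.val ≤ 1 from hy)
  zero_mem' := zero_le (a := (1 : ℝ≥0))

/-- The semiring `[0, 1]` with `max` as addition and the usual product. -/
abbrev UnitMax : Type := unitSubsemiring

namespace UnitMax

lemma isUnit_iff (x : UnitMax) : IsUnit x ↔ x.1.val = 1 := by
  constructor
  · rintro ⟨u, rfl⟩
    have h : (u.1).1.val * (u.2).1.val = 1 := congrArg (fun z : UnitMax => z.1.val) u.3
    have h1 : (u.1).1.val ≤ 1 := u.1.2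
    have h2 : (u.2).1.val ≤ 1 := u.2.2
    refine le_antisymm h1 ?_
    calc (1 : ℝ≥0) = (u.1).1.val * (u.2).1.val := h.symm
      _ ≤ (u.1).1.val * 1 := mul_le_mul_right h2 _
      _ = (u.1).1.val := mul_one _
  · intro h
    have : x = 1 := Subtype.ext h
    rw [this]
    exact isUnit_one

instance : Nontrivial UnitMax :=
  ⟨0, 1, fun h => zero_ne_one (α := ℝ≥0) (congrArg (fun z : UnitMax => z.1.val) h)⟩

instance : IsLocalRing UnitMax where
  isUnit_or_isUnit_of_add_one {a b} h := by
    simp only [isUnit_iff]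
    have h' : max a.1.val b.1.val = 1 := congrArg (fun z : UnitMax => z.1.val) h
    rcases max_choice a.1.val b.1.val with e | e
    · left; rw [← e, h']
    · right; rw [← e, h']

/-- The Frobenius automorphism `x ↦ x ^ t` of `[0, 1]`, for `t > 0`: the restriction of the
Frobenius automorphism of the tropical semifield. -/
def frobEquiv (t : {t : ℝ // 0 < t}) : RingAut UnitMax where
  toFun x := ⟨RMax.frob t x.1, NNReal.rpow_le_one x.2 t.2.le⟩
  invFun x := ⟨(RMax.frob t).symm x.1, NNReal.rpow_le_one x.2 (inv_pos.2 t.2).le⟩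
  left_inv x := Subtype.ext ((RMax.frob t).symm_apply_apply x.1)
  right_inv x := Subtype.ext ((RMax.frob t).apply_symm_apply x.1)
  map_mul' x y := Subtype.ext (map_mul (RMax.frob t) x.1 y.1)
  map_add' x y := Subtype.ext (map_add (RMax.frob t) x.1 y.1)

/-- The action `t ↦ Fr_t` of the positive reals on `[0, 1]`. -/
def Fr : {t : ℝ // 0 < t} →* RingAut UnitMax where
  toFun := frobEquiv
  map_one' := RingEquiv.ext fun x => Subtype.ext (NNReal.rpow_one x.1.val)
  map_mul' s t := RingEquiv.ext fun x => Subtype.ext (by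
    change x.1.val ^ (s.1 * t.1) = (x.1.val ^ t.1) ^ s.1
    rw [mul_comm, NNReal.rpow_mul])

end UnitMax

/-! ## Adèles -/

open IsDedekindDomain NumberField

/-- The ring of adèles of `ℚ`. -/
abbrev Adele : Type := AdeleRing ℤ ℚ

/-- The archimedean component of the ring of adèles is the field of real numbers. -/
def archEquiv : InfiniteAdeleRing ℚ ≃+* ℝ :=
  (RingEquiv.piUnique fun v : InfinitePlace ℚ => v.Completion).trans
    (InfinitePlace.Completion.ringEquivRealOfIsReal (v := default) Rat.isReal_infinitePlace)

/-- The real component of an adèle. -/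
def arch (a : Adele) : ℝ := archEquiv a.1

/-- The profinite completion of `ℤ`, as the subring of the ring of finite adèles that consists of
the elements that are integral at every prime. -/
def ZHat : Subring (FiniteAdeleRing ℤ ℚ) where
  carrier := {a | ∀ v : HeightOneSpectrum ℤ, a v ∈ v.adicCompletionIntegers ℚ}
  mul_mem' ha hb v := mul_mem (ha v) (hb v)
  one_mem' v := one_mem (v.adicCompletionIntegers ℚ)
  add_mem' ha hb v := add_mem (ha v) (hb v)
  zero_mem' v := zero_mem (v.adicCompletionIntegers ℚ)
  neg_mem' ha v := neg_mem (ha v)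

/-- The principal idèles. -/
def principalIdeles : Subgroup Adeleˣ := (Units.map (algebraMap ℚ Adele).toMonoidHom).range

/-- The group of units of `ZHat`, as a group of idèles with archimedean component `1`. -/
def ZHatUnits : Subgroup Adeleˣ where
  carrier := {u | u.1.1 = 1 ∧ u.1.2 ∈ ZHat ∧ (u⁻¹).1.2 ∈ ZHat}
  mul_mem' {u v} hu hv := by
    refine ⟨?_, ZHat.mul_mem hu.2.1 hv.2.1, ?_⟩
    · change u.1.1 * v.1.1 = 1
      rw [hu.1, hv.1, one_mul]
    · rw [mul_inv]
      exact ZHat.mul_mem hu.2.2 hv.2.2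
  one_mem' := ⟨rfl, ZHat.one_mem, by rw [inv_one]; exact ZHat.one_mem⟩
  inv_mem' {u} hu := by
    refine ⟨?_, hu.2.2, by rw [inv_inv]; exact hu.2.1⟩
    have h : u.1.1 * (u⁻¹).1.1 = 1 := congrArg (fun z : Adele => z.1) u.mul_inv
    rwa [hu.1, one_mul] at h

/-- The idèle class group of `ℚ`. -/
abbrev IdeleClassGroup : Type := Adeleˣ ⧸ principalIdeles

/-- The idèle class group of `ℚ` modulo the image of the units of `ZHat`. -/
abbrev IdeleClassModZHat : Type :=
  IdeleClassGroup ⧸ ZHatUnits.map (QuotientGroup.mk' principalIdeles)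

/-- The relation on adèles whose classes form the double quotient `ℚˣ \ 𝔸 / ZHatˣ`. -/
instance doubleSetoid : Setoid Adele where
  r a b := ∃ q ∈ principalIdeles, ∃ u ∈ ZHatUnits, b = q.1 * a * u.1
  iseqv :=
    { refl := fun a => ⟨1, one_mem _, 1, one_mem _, by simp⟩
      symm := by
        rintro a b ⟨q, hq, u, hu, rfl⟩
        refine ⟨q⁻¹, inv_mem hq, u⁻¹, inv_mem hu, ?_⟩
        rw [mul_assoc, mul_assoc, Units.mul_inv, mul_one, Units.inv_mul_cancel_left]
      trans := by
        rintro a b c ⟨q, hq, u, hu, rfl⟩ ⟨r, hr, v, hv, rfl⟩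
        refine ⟨r * q, mul_mem hr hq, u * v, mul_mem hu hv, ?_⟩
        rw [Units.val_mul, Units.val_mul]
        ring }

/-- The double quotient `ℚˣ \ 𝔸 / ZHatˣ`. -/
def DoubleQuotient : Type := Quotient doubleSetoid

namespace DoubleQuotient

/-- Idèles act on the double quotient by multiplication. -/
instance : MulAction Adeleˣ DoubleQuotient where
  smul j := Quotient.map (fun a => j.1 * a) (by
    rintro a b ⟨q, hq, u, hu, rfl⟩
    exact ⟨q, hq, u, hu, by ring⟩)
  one_smul x := by
    obtain ⟨a, rfl⟩ := Quotient.exists_rep x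
    exact congrArg (Quotient.mk doubleSetoid) (one_mul a)
  mul_smul j k x := by
    obtain ⟨a, rfl⟩ := Quotient.exists_rep x
    exact congrArg (Quotient.mk doubleSetoid) (mul_assoc j.1 k.1 a)

/-- The action of the idèle class group on the double quotient. -/
def ideleClassPerm : IdeleClassGroup →* Equiv.Perm DoubleQuotient :=
  QuotientGroup.lift principalIdeles (MulAction.toPermHom Adeleˣ DoubleQuotient) fun q hq => by
    ext x
    obtain ⟨a, rfl⟩ := Quotient.exists_rep x
    exact Quotient.sound (Setoid.symm ⟨q, hq, 1, one_mem _, by simp⟩)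

/-- The action of the idèle class group modulo the units of `ZHat` on the double quotient. -/
def ideleClassModPerm : IdeleClassModZHat →* Equiv.Perm DoubleQuotient :=
  QuotientGroup.lift _ ideleClassPerm (by
    rintro _ ⟨u, hu, rfl⟩
    ext x
    obtain ⟨a, rfl⟩ := Quotient.exists_rep x
    exact Quotient.sound (Setoid.symm ⟨1, one_mem _, u, hu, by simp [mul_comm]⟩))

instance : MulAction IdeleClassModZHat DoubleQuotient :=
  MulAction.compHom DoubleQuotient ideleClassModPerm

end DoubleQuotient

/-- The idèle with archimedean component `t` and all other components equal to `1`. -/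
def archIdele (t : {t : ℝ // 0 < t}) : Adeleˣ where
  val := (archEquiv.symm t.1, 1)
  inv := (archEquiv.symm (t.1)⁻¹, 1)
  val_inv := Prod.ext (by
    change archEquiv.symm t.1 * archEquiv.symm (t.1)⁻¹ = 1
    rw [← map_mul, mul_inv_cancel₀ t.2.ne', map_one]) (one_mul _)
  inv_val := Prod.ext (by
    change archEquiv.symm (t.1)⁻¹ * archEquiv.symm t.1 = 1
    rw [← map_mul, inv_mul_cancel₀ t.2.ne', map_one]) (one_mul _)

/-- The class of `archIdele t` in the idèle class group modulo the units of `ZHat`. -/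
def archClass (t : {t : ℝ // 0 < t}) : IdeleClassModZHat :=
  QuotientGroup.mk (QuotientGroup.mk (archIdele t))

/-! ## The point attached to an adèle -/

/-- The group `H_a` of rational numbers `q` such that `q a` lies in `ZHat`. -/
def ratGroup (a : FiniteAdeleRing ℤ ℚ) : AddSubgroup ℚ where
  carrier := {q | algebraMap ℚ (FiniteAdeleRing ℤ ℚ) q * a ∈ ZHat}
  add_mem' {q r} hq hr := by
    change algebraMap ℚ (FiniteAdeleRing ℤ ℚ) (q + r) * a ∈ ZHat
    rw [map_add, add_mul]
    exact ZHat.add_mem hq hr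
  zero_mem' := by
    change algebraMap ℚ (FiniteAdeleRing ℤ ℚ) 0 * a ∈ ZHat
    rw [map_zero, MulZeroClass.zero_mul]
    exact ZHat.zero_mem
  neg_mem' {q} hq := by
    change algebraMap ℚ (FiniteAdeleRing ℤ ℚ) (-q) * a ∈ ZHat
    rw [map_neg, neg_mul]
    exact ZHat.neg_mem hq

/-- The semiring `(H ∪ {∞}, min, +)` of nonnegative elements of an ordered group of rationals. -/
abbrev NonnegSemiring (H : AddSubgroup ℚ) : Type := Tropical (WithTop {h : H // 0 ≤ h})

/-- For `r ≠ 0` the map `h ↦ exp (- |r| h)`, `∞ ↦ 0`; for `r = 0` the map that sends `0` to `1` and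
everything else to `0`. -/
def expVal (H : AddSubgroup ℚ) (r : ℝ) : WithTop {h : H // 0 ≤ h} → ℝ
  | none => 0
  | some h => if r = 0 then (if h = 0 then 1 else 0) else Real.exp (-(|r| * ((h : H) : ℚ)))

/-- A point `P` over `[0, 1]` corresponds to the adèle `a = (r, a_f)` if the stalk at `P` is
isomorphic to the semiring of nonnegative elements of `H_{a_f}`, in such a way that the morphism to
`[0, 1]` becomes the map `expVal`. -/
def Corresponds (P : Point UnitMax) (a : Adele) : Prop :=
  ∃ e : NonnegSemiring (ratGroup a.2) ≃+* LocalSemiring P.base,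
    ∀ h : WithTop {h : ratGroup a.2 // 0 ≤ h},
      ((P.hom (e (Tropical.trop h))).1.val : ℝ) = expVal (ratGroup a.2) (arch a) h

end ArithSite

end

noncomputable section

namespace ArithSite

open IsDedekindDomain NumberField HeightOneSpectrum

/-! ## Subgroups of `ℚ` and finite adèles -/

/-! Both sides classify the same data: a nonzero subgroup `H` of `ℚ` with a real number `|r| ≥ 0`,
up to simultaneous scaling by positive rationals.

Geometric side. A point `p` is controlled by its fiber, the inverse image of the representable
presheaf, with its action of the positive integers. Every element of any `p^*(F)` comes from a
section of `F` at an element of the fiber (`exists_section`). Hence any two elements of the fiber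
are multiples of a third, and the action is free. Measuring everything against one element turns the
fiber into the positive part of some `H` (`exists_fiberCoord`) and the stalk into `𝒪(H)`.
Conversely, the positive part of a nonzero `H` is a flat functor and defines a point
(`subgroupPoint`). The fiber can be read off the stalk as the set of elements other than `0` and
`1`, with `k` acting as the `k`-th power, so every isomorphism of stalks comes from an isomorphism
of points (`exists_iso_of_stalkEquiv`). Any two positive elements of `H` have a common positive
multiple, and roots of nonnegative reals are unique, so a morphism `𝒪(H) → [0,1]` is determined by
its value at one positive `h₀`. Locality means that this value is not `1`: it is `0` (the case `r =
0`) or `exp (-|r| h₀)` with `r ≠ 0` (`exists_eq_expHom`). The same commensurability shows that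
isomorphisms `𝒪(H) ≃ 𝒪(K)` are scalings.

Adelic side. Membership in a subgroup of `ℚ` is a local condition, so every nonzero `H` is some
`H_a`; moreover `H_a` determines all absolute values `|a_v|`, hence `a` up to a unit of `ZHat`
(`exists_ratGroup_eq`, `exists_unit_of_ratGroup_eq`). Multiplying an adèle by `q ∈ ℚˣ` divides `H_a`
by `|q|` and multiplies `|r|` by `|q|`. The sign of `r`, invisible on the geometric side, is
absorbed by `-1`, which is both rational and a unit of `ZHat`.

Frobenius raises `exp (-|r| h)` to the power `λ`, that is, it replaces `r` by `λ r`. The map `θ` is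
an isomorphism because finite idèles are products of a positive rational and a unit of `ZHat`, and
`1` is the only positive rational that is such a unit. -/

lemma exists_ne_zero_of_ne_bot {H : AddSubgroup ℚ} (hH : H ≠ ⊥) : ∃ h ∈ H, h ≠ 0 := by
  contrapose! hH
  exact (AddSubgroup.eq_bot_iff_forall H).2 hH

lemma mem_ZHat {a : FiniteAdeleRing ℤ ℚ} : a ∈ ZHat ↔ ∀ v, Valued.v (a v) ≤ 1 := Iff.rfl

lemma FiniteAdele.mul_apply (a b : FiniteAdeleRing ℤ ℚ) (v : HeightOneSpectrum ℤ) :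
    (a * b) v = a v * b v := rfl

lemma mem_ratGroup {a : FiniteAdeleRing ℤ ℚ} {q : ℚ} :
    q ∈ ratGroup a ↔ ∀ v : HeightOneSpectrum ℤ, v.valuation ℚ q * Valued.v (a v) ≤ 1 := by
  change algebraMap ℚ (FiniteAdeleRing ℤ ℚ) q * a ∈ ZHat ↔ _
  rw [mem_ZHat]
  refine forall_congr' fun v => ?_
  rw [FiniteAdele.mul_apply, map_mul, FiniteAdeleRing.algebraMap_apply,
    valuedAdicCompletion_eq_valuation']

/-- Membership in a subgroup of `ℚ` can be checked at each prime. -/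
lemma mem_of_forall_valuation_le (H : AddSubgroup ℚ) {q : ℚ}
    (hq : ∀ v : HeightOneSpectrum ℤ, ∃ h ∈ H, v.valuation ℚ q ≤ v.valuation ℚ h) : q ∈ H := by
  by_cases hq0 : q = 0
  · rw [hq0]; exact H.zero_mem
  -- The denominators `n` with `n q ∈ H` form an ideal. If it were proper it would lie in a maximal
  -- ideal `M`; but at the place `M` the hypothesis gives `h ∈ H` with `q / h` integral, hence `d ∉
  -- M` with `d q ∈ ℤ h ⊆ H`.
  let I : Ideal ℤ :=
    { carrier := {n | (n : ℚ) * q ∈ H}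
      add_mem' := fun {m n} hm hn => by
        simp only [Set.mem_ofPred_eq, Int.cast_add, add_mul] at *
        exact H.add_mem hm hn
      zero_mem' := by simp
      smul_mem' := fun m n hn => by
        simp only [Set.mem_ofPred_eq, smul_eq_mul, Int.cast_mul, mul_assoc] at *
        rw [← zsmul_eq_mul]
        exact H.zsmul_mem hn m }
  by_contra hcon
  have hI : I ≠ ⊤ := fun h => hcon <| by
    have : (1 : ℤ) ∈ I := h ▸ Submodule.mem_top
    simpa [I] using this
  obtain ⟨M, hM, hIM⟩ := Ideal.exists_le_maximal I hI
  have hM0 : M ≠ ⊥ := Ring.ne_bot_of_isMaximal_of_not_isField hM Int.not_isField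
  let v : HeightOneSpectrum ℤ := ⟨M, hM.isPrime, hM0⟩
  obtain ⟨h, hh, hle⟩ := hq v
  have hvq : v.valuation ℚ q ≠ 0 := (Valuation.ne_zero_iff _).2 hq0
  have hvh : v.valuation ℚ h ≠ 0 := fun h0 => hvq (le_zero_iff.1 (h0 ▸ hle))
  have hh0 : h ≠ 0 := (Valuation.ne_zero_iff _).1 hvh
  have hx : v.valuation ℚ (q / h) ≤ 1 := by
    rw [map_div₀]
    exact div_le_one_of_le₀ hle zero_le
  obtain ⟨n, d, hnd⟩ := exists_primeCompl_mul_eq_of_integer v (q / h) hx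
  refine d.2 (hIM ?_)
  change ((d : ℤ) : ℚ) * q ∈ H
  have : ((d : ℤ) : ℚ) * q = n • h := by
    simp only [eq_intCast] at hnd
    rw [zsmul_eq_mul, ← hnd]
    field_simp
  rw [this]
  exact H.zsmul_mem hh n

/-- If the `v`-adic absolute values on `H` are unbounded, `x = 0` works; otherwise discreteness
gives an element of `H` of largest absolute value, and `x` is its inverse. The last clause is the
form that `mem_of_forall_valuation_le` consumes. -/
lemma exists_local_generator (H : AddSubgroup ℚ) (hH : H ≠ ⊥) (v : HeightOneSpectrum ℤ) :
    ∃ x : v.adicCompletion ℚ, (∀ h ∈ H, v.valuation ℚ h * Valued.v x ≤ 1) ∧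
      ∀ q, v.valuation ℚ q * Valued.v x ≤ 1 → ∃ h ∈ H, v.valuation ℚ q ≤ v.valuation ℚ h := by
  by_cases hb : ∀ q, ∃ h ∈ H, v.valuation ℚ q ≤ v.valuation ℚ h
  · exact ⟨0, by simp, fun q _ => hb q⟩
  push Not at hb
  obtain ⟨q₀, hq₀⟩ := hb
  obtain ⟨h₀, hh₀, h₀0⟩ := exists_ne_zero_of_ne_bot hH
  have hval : ∀ {x : ℚ}, x ≠ 0 → v.valuation ℚ x ≠ 0 := fun h => (Valuation.ne_zero_iff _).2 h
  -- The condition `h ≠ 0` matters: `WithZero.log 0 = 0` is a default value that could otherwise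
  -- pass for the maximum.
  obtain ⟨m, ⟨h₁, hh₁, h₁0, rfl⟩, hmax⟩ := Int.exists_greatest_of_bdd
    (P := fun n => ∃ h ∈ H, h ≠ 0 ∧ WithZero.log (v.valuation ℚ h) = n)
    ⟨WithZero.log (v.valuation ℚ q₀), by
      rintro _ ⟨h, hh, h0, rfl⟩
      exact WithZero.log_le_log (hval h0)
        (fun h0 => not_lt_zero (h0 ▸ hq₀ h hh)) |>.2 (hq₀ h hh).le⟩
    ⟨_, h₀, hh₀, h₀0, rfl⟩
  have hmax' : ∀ h ∈ H, v.valuation ℚ h ≤ v.valuation ℚ h₁ := fun h hh => by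
    by_cases h0 : h = 0
    · rw [h0, map_zero]; exact zero_le
    · exact (WithZero.log_le_log (hval h0) (hval h₁0)).1 (hmax _ ⟨h, hh, h0, rfl⟩)
  have hv1 : Valued.v (algebraMap ℚ (FiniteAdeleRing ℤ ℚ) h₁⁻¹ v) = (v.valuation ℚ h₁)⁻¹ := by
    rw [FiniteAdeleRing.algebraMap_apply, valuedAdicCompletion_eq_valuation', map_inv₀]
  refine ⟨(algebraMap ℚ (FiniteAdeleRing ℤ ℚ) h₁⁻¹ v), fun h hh => ?_, fun q hq => ⟨h₁, hh₁, ?_⟩⟩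
  · rw [hv1, ← div_eq_mul_inv]
    exact div_le_one_of_le₀ (hmax' h hh) zero_le
  · rwa [hv1, ← div_eq_mul_inv, div_le_one₀ (zero_lt_iff.2 (hval h₁0))] at hq

/-- The local generators form a finite adèle because a single nonzero `h₀ ∈ H` bounds them all:
`|x_v| ≤ |h₀|_v⁻¹`, which is at most `1` for almost every `v`. -/
lemma exists_ratGroup_eq (H : AddSubgroup ℚ) (hH : H ≠ ⊥) : ∃ a, ratGroup a = H := by
  choose x hx hx' using exists_local_generator H hH
  obtain ⟨h₀, hh₀, h₀0⟩ := exists_ne_zero_of_ne_bot hH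
  let a : FiniteAdeleRing ℤ ℚ := ⟨x, by
    refine (HeightOneSpectrum.Support.finite ℤ h₀⁻¹).subset fun v hv => ?_
    change 1 < v.valuation ℚ h₀⁻¹
    have hv : ¬ Valued.v (x v) ≤ 1 := hv
    rw [map_inv₀]
    contrapose! hv
    have h1 := hx v h₀ hh₀
    have hne : v.valuation ℚ h₀ ≠ 0 := (Valuation.ne_zero_iff _).2 h₀0
    calc Valued.v (x v) = (v.valuation ℚ h₀)⁻¹ * (v.valuation ℚ h₀ * Valued.v (x v)) := by
          rw [inv_mul_cancel_left₀ hne]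
      _ ≤ 1 := mul_le_one' hv h1⟩
  refine ⟨a, le_antisymm (fun q hq => ?_) fun h hh => mem_ratGroup.2 fun v => hx v h hh⟩
  exact mem_of_forall_valuation_le H fun v => hx' v q (mem_ratGroup.1 hq v)

open Classical in
-- A finite adèle is integral outside finitely many places, and the product of one denominator for
-- each of these places is a nonzero integer that clears them all.
lemma ratGroup_ne_bot (a : FiniteAdeleRing ℤ ℚ) : ratGroup a ≠ ⊥ := by
  have hfin : {v : HeightOneSpectrum ℤ | ¬ Valued.v (a v) ≤ 1}.Finite := a.2
  choose b hb hab using fun v : HeightOneSpectrum ℤ =>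
    adicCompletion.mul_nonZeroDivisor_mem_adicCompletionIntegers v (a v)
  have hN : (∏ v ∈ hfin.toFinset, b v) ≠ 0 :=
    Finset.prod_ne_zero_iff.2 fun v _ => nonZeroDivisors.ne_zero (hb v)
  suffices h : ((∏ v ∈ hfin.toFinset, b v : ℤ) : ℚ) ∈ ratGroup a from fun h0 =>
    hN (Int.cast_eq_zero.1 ((AddSubgroup.eq_bot_iff_forall _).1 h0 _ h))
  refine mem_ratGroup.2 fun v => ?_
  by_cases hv : Valued.v (a v) ≤ 1
  · exact mul_le_one' (v.valuation_le_one _) hv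
  · rw [← Finset.mul_prod_erase _ _ (hfin.mem_toFinset.2 hv), Int.cast_mul, map_mul,
      mul_right_comm]
    refine mul_le_one' ?_ (v.valuation_le_one _)
    have := (mem_adicCompletionIntegers ℤ ℚ v).1 (hab v)
    rw [map_mul, valuedAdicCompletion_eq_valuation, mul_comm] at this
    exact this

/-! ### Recovering a finite adèle from its group, up to units -/

lemma exists_valuation_prime (v : HeightOneSpectrum ℤ) : ∃ p : ℚ, v.valuation ℚ p = .exp (-1) ∧
    ∀ w : HeightOneSpectrum ℤ, w ≠ v → w.valuation ℚ p = 1 := by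
  obtain ⟨p, hp⟩ := (IsPrincipalIdealRing.principal v.asIdeal).principal
  have hp' : v.asIdeal = Ideal.span {p} := hp
  have hp0 : p ≠ 0 := fun h => v.ne_bot (by rw [hp', h]; simp)
  refine ⟨algebraMap ℤ ℚ p, ?_, fun w hw => ?_⟩
  · rw [valuation_of_algebraMap, intValuation_singleton v hp0 hp']
  · rw [valuation_of_algebraMap, intValuation_eq_one_iff]
    intro hpw
    refine hw (HeightOneSpectrum.ext (v.isMaximal.eq_of_le w.isPrime.ne_top ?_).symm)
    rw [hp', Ideal.span_singleton_le_iff_mem]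
    exact hpw

/-- If `|a_v| < |b_v|`, a nonzero element of `H_a` can be adjusted at `v` alone, by a power of the
prime, so that it just fails to lie in `H_b` but still lies in `H_a`. -/
lemma valued_le_of_ratGroup_le {a b : FiniteAdeleRing ℤ ℚ} (h : ratGroup a ≤ ratGroup b)
    (v : HeightOneSpectrum ℤ) : Valued.v (b v) ≤ Valued.v (a v) := by
  by_contra! hlt
  obtain ⟨N, hN, hN0⟩ := exists_ne_zero_of_ne_bot (ratGroup_ne_bot a)
  obtain ⟨p, hpv, hpw⟩ := exists_valuation_prime v
  have hb0 : Valued.v (b v) ≠ 0 := (zero_le.trans_lt hlt).ne'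
  have hNv : v.valuation ℚ N ≠ 0 := (Valuation.ne_zero_iff _).2 hN0
  -- As `p` has logarithm `-1` at `v`, this exponent makes the product of `N * p ^ j` with `b v`
  -- have logarithm exactly `1`; its product with `a v` then has logarithm at most `0`, or vanishes.
  set j : ℤ := WithZero.log (v.valuation ℚ N) + WithZero.log (Valued.v (b v)) - 1 with hj
  have hq : v.valuation ℚ (N * p ^ j) = .exp (1 - WithZero.log (Valued.v (b v))) := by
    rw [map_mul, map_zpow₀, hpv, ← WithZero.exp_log hNv, ← WithZero.exp_zsmul, ← WithZero.exp_add]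
    congr 1
    rw [smul_eq_mul, hj]; ring
  have hmem : N * p ^ j ∈ ratGroup a := mem_ratGroup.2 fun w => by
    by_cases hw : w = v
    · subst hw
      rw [hq]
      by_cases ha0 : Valued.v (a w) = 0
      · rw [ha0, mul_zero]; exact zero_le
      · rw [← WithZero.exp_log ha0, ← WithZero.exp_add, ← WithZero.exp_zero, WithZero.exp_le_exp]
        have := (WithZero.log_lt_log ha0 hb0).2 hlt
        omega
    · rw [map_mul, map_zpow₀, hpw w hw, one_zpow, mul_one]
      exact mem_ratGroup.1 hN w
  have := mem_ratGroup.1 (h hmem) v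
  rw [hq, ← WithZero.exp_log hb0, ← WithZero.exp_add, ← WithZero.exp_zero,
    WithZero.exp_le_exp, WithZero.log_exp] at this
  omega

lemma valued_eq_of_ratGroup_eq {a b : FiniteAdeleRing ℤ ℚ} (h : ratGroup a = ratGroup b)
    (v : HeightOneSpectrum ℤ) : Valued.v (a v) = Valued.v (b v) :=
  le_antisymm (valued_le_of_ratGroup_le h.ge v) (valued_le_of_ratGroup_le h.le v)

/-- The idèle with archimedean component `1` and given finite component. -/
def finiteIdele (u : (FiniteAdeleRing ℤ ℚ)ˣ) : Adeleˣ := MulEquiv.prodUnits.symm (1, u)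

lemma finiteIdele_mem {u : (FiniteAdeleRing ℤ ℚ)ˣ} (hu : ∀ v, Valued.v (u.1 v) = 1) :
    finiteIdele u ∈ ZHatUnits := by
  refine ⟨rfl, fun v => (hu v).le, fun v => ?_⟩
  change Valued.v ((u⁻¹).1 v) ≤ 1
  have h : Valued.v (u.1 v) * Valued.v ((u⁻¹).1 v) = 1 := by
    rw [← map_mul, ← FiniteAdele.mul_apply, u.mul_inv]
    exact map_one _
  rw [hu v, one_mul] at h
  exact h.le

open Classical in
-- The absolute values of `a` and `b` agree at every place, so `b / a` is a local unit wherever `a v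
-- ≠ 0`; where `a v = 0`, also `b v = 0`, and `1` serves.
lemma exists_unit_of_ratGroup_eq {a b : FiniteAdeleRing ℤ ℚ} (h : ratGroup a = ratGroup b) :
    ∃ u ∈ ZHatUnits, u.1.1 = 1 ∧ b = a * u.1.2 := by
  have hv := valued_eq_of_ratGroup_eq h
  let x : ∀ v : HeightOneSpectrum ℤ, v.adicCompletion ℚ := fun v =>
    if a v = 0 then 1 else b v / a v
  have hx : ∀ v, Valued.v (x v) = 1 := fun v => by
    by_cases ha : a v = 0
    · simp only [x, if_pos ha, map_one]
    · simp only [x, if_neg ha, map_div₀, hv v]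
      exact div_self fun h0 => ha ((Valuation.zero_iff _).1 ((hv v).trans h0))
  have hx0 : ∀ v, x v ≠ 0 := fun v h0 => by
    have := hx v
    rw [h0, map_zero] at this
    exact zero_ne_one this
  let u : (FiniteAdeleRing ℤ ℚ)ˣ :=
    { val := ⟨x, Filter.Eventually.of_forall fun v => (hx v).le⟩
      inv := ⟨fun v => (x v)⁻¹, Filter.Eventually.of_forall fun v => by
        change Valued.v (x v)⁻¹ ≤ 1
        rw [map_inv₀, hx v, inv_one]⟩
      val_inv := FiniteAdeleRing.ext ℚ fun v => mul_inv_cancel₀ (hx0 v)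
      inv_val := FiniteAdeleRing.ext ℚ fun v => inv_mul_cancel₀ (hx0 v) }
  refine ⟨finiteIdele u, finiteIdele_mem hx, rfl, FiniteAdeleRing.ext ℚ fun v => ?_⟩
  change b v = a v * x v
  by_cases ha : a v = 0
  · rw [ha, MulZeroClass.zero_mul]
    refine (Valuation.zero_iff (Valued.v (R := v.adicCompletion ℚ))).1 ?_
    rw [← hv v, ha, map_zero]
  · simp only [x, if_neg ha]
    field_simp

/-! ### Effect of rationals and units on the groups `H_a` -/

lemma mem_ratGroup_algebraMap_mul {q : ℚ} (a : FiniteAdeleRing ℤ ℚ) {r : ℚ} :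
    r ∈ ratGroup (algebraMap ℚ _ q * a) ↔ r * q ∈ ratGroup a := by
  change algebraMap ℚ _ r * (algebraMap ℚ _ q * a) ∈ ZHat ↔ algebraMap ℚ _ (r * q) * a ∈ ZHat
  rw [map_mul, mul_assoc]

lemma ratGroup_mul_unit (a : FiniteAdeleRing ℤ ℚ) {u : Adeleˣ} (hu : u ∈ ZHatUnits) :
    ratGroup (a * u.1.2) = ratGroup a := by
  have key : ∀ (c : FiniteAdeleRing ℤ ℚ) {w : FiniteAdeleRing ℤ ℚ}, w ∈ ZHat →
      ratGroup c ≤ ratGroup (c * w) := fun c w hw q hq => by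
    change algebraMap ℚ _ q * (c * w) ∈ ZHat
    rw [← mul_assoc]
    exact ZHat.mul_mem hq hw
  refine le_antisymm ?_ (key a hu.2.1)
  have h := key (a * u.1.2) hu.2.2
  have huu : u.1.2 * (u⁻¹).1.2 = 1 := congrArg (fun z : Adele => z.2) u.mul_inv
  rwa [mul_assoc, huu, mul_one] at h

lemma mem_ratGroup_one {q : ℚ} : q ∈ ratGroup 1 ↔ ∃ n : ℤ, (n : ℚ) = q := by
  have h1 : ∀ v : HeightOneSpectrum ℤ,
      Valued.v ((1 : FiniteAdeleRing ℤ ℚ) v) = 1 := fun v => map_one _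
  rw [mem_ratGroup]
  simp only [h1, mul_one]
  constructor
  · intro h
    obtain ⟨n, hn⟩ := mem_integers_of_valuation_le_one ℚ q h
    exact ⟨n, hn⟩
  · rintro ⟨n, rfl⟩ v
    exact v.valuation_le_one n

lemma exists_neg_unit {u : Adeleˣ} (hu : u ∈ ZHatUnits) :
    ∃ w ∈ ZHatUnits, w.1.2 = -u.1.2 := by
  refine ⟨finiteIdele (-1) * u, mul_mem (finiteIdele_mem fun v => ?_) hu, neg_one_mul _⟩
  change Valued.v (-1 : v.adicCompletion ℚ) = 1
  rw [Valuation.map_neg, map_one]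

/-- This is class number one. For invertible `a`, multiplication by a nonzero `N ∈ H_{a⁻¹}` carries
`H_a` into `H_1 = ℤ`, so `H_a` is cyclic, say `c ℤ` with `c > 0`. This is also the group of `c⁻¹`,
and equal groups mean equality up to a unit. -/
lemma exists_unit_of_isUnit (a : (FiniteAdeleRing ℤ ℚ)ˣ) :
    ∃ g : ℚ, 0 < g ∧ ∃ u ∈ ZHatUnits, algebraMap ℚ _ g * u.1.2 = a.1 := by
  obtain ⟨N, hN, hN0⟩ := exists_ne_zero_of_ne_bot (ratGroup_ne_bot a⁻¹.1)
  have hint : ∀ q ∈ ratGroup a.1, ∃ n : ℤ, (n : ℚ) = N * q := fun q hq => by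
    refine mem_ratGroup_one.1 ?_
    change algebraMap ℚ _ (N * q) * 1 ∈ ZHat
    have h := ZHat.mul_mem hN hq
    have e : algebraMap ℚ (FiniteAdeleRing ℤ ℚ) N * (a⁻¹).1 * (algebraMap ℚ _ q * a.1) =
        algebraMap ℚ _ (N * q) * 1 := by
      rw [map_mul, mul_one, mul_mul_mul_comm, a.inv_mul, mul_one]
    rwa [e] at h
  let K : AddSubgroup ℤ :=
    (ratGroup a.1).comap ((AddMonoidHom.mulLeft N⁻¹).comp (Int.castAddHom ℚ))
  obtain ⟨m, hm⟩ := Int.subgroup_cyclic K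
  have hgen : ∀ q, q ∈ ratGroup a.1 ↔ ∃ k : ℤ, q = k * (N⁻¹ * m) := fun q => by
    have hK : ∀ n : ℤ, N⁻¹ * n ∈ ratGroup a.1 ↔ ∃ k : ℤ, k * m = n := fun n => by
      change n ∈ K ↔ _
      rw [hm, AddSubgroup.mem_closure_singleton]
      simp
    constructor
    · intro hq
      obtain ⟨n, hn⟩ := hint q hq
      have e : q = N⁻¹ * n := by rw [hn, inv_mul_cancel_left₀ hN0]
      rw [e] at hq ⊢
      obtain ⟨k, rfl⟩ := (hK n).1 hq
      exact ⟨k, by push_cast; ring⟩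
    · rintro ⟨k, rfl⟩
      have := (hK (k * m)).2 ⟨k, rfl⟩
      push_cast at this
      rwa [mul_left_comm]
  have hm0 : N⁻¹ * (m : ℚ) ≠ 0 := fun h0 => ratGroup_ne_bot a.1 <| by
    refine (AddSubgroup.eq_bot_iff_forall _).2 fun q hq => ?_
    obtain ⟨k, rfl⟩ := (hgen q).1 hq
    rw [h0, mul_zero]
  set c : ℚ := |N⁻¹ * (m : ℚ)| with hc
  have hc0 : 0 < c := abs_pos.2 hm0
  have heq : ratGroup (algebraMap ℚ _ c⁻¹ * 1) = ratGroup a.1 := by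
    ext q
    rw [mem_ratGroup_algebraMap_mul, mem_ratGroup_one, hgen]
    have : ∀ n : ℤ, (n : ℚ) = q * c⁻¹ ↔ q = n * c := fun n => by
      rw [eq_mul_inv_iff_mul_eq₀ hc0.ne', eq_comm]
    simp only [this]
    rcases abs_choice (N⁻¹ * (m : ℚ)) with h | h
    · rw [hc, h]
    · rw [hc, h]
      constructor <;>
      · rintro ⟨n, hn⟩
        exact ⟨-n, by rw [hn]; push_cast; ring⟩
  obtain ⟨u, hu, -, h⟩ := exists_unit_of_ratGroup_eq heq
  exact ⟨c⁻¹, inv_pos.2 hc0, u, hu, by rw [h, mul_one]⟩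

/-! ## Idèle classes -/

lemma arch_mul (a b : Adele) : arch (a * b) = arch a * arch b := map_mul archEquiv a.1 b.1

lemma arch_algebraMap (q : ℚ) : arch (algebraMap ℚ Adele q) = q := by
  let f : ℚ →+* ℝ := archEquiv.toRingHom.comp
    ((RingHom.fst (InfiniteAdeleRing ℚ) (FiniteAdeleRing ℤ ℚ)).comp (algebraMap ℚ Adele))
  exact eq_ratCast f q

lemma arch_of_mem_ZHatUnits {u : Adeleˣ} (hu : u ∈ ZHatUnits) : arch u.1 = 1 := by
  rw [arch, hu.1, map_one]

lemma arch_archIdele (t : {t : ℝ // 0 < t}) : arch (archIdele t).1 = t.1 :=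
  archEquiv.apply_symm_apply t.1

lemma adele_ext {a b : Adele} (h : arch a = arch b) (h' : a.2 = b.2) : a = b :=
  Prod.ext (archEquiv.injective h) h'

lemma archIdele_mul (s t : {t : ℝ // 0 < t}) : archIdele (s * t) = archIdele s * archIdele t :=
  Units.ext <| adele_ext (by
    rw [Units.val_mul, arch_mul, arch_archIdele, arch_archIdele, arch_archIdele]; rfl)
    (one_mul (1 : FiniteAdeleRing ℤ ℚ)).symm

/-- The principal idèle of a nonzero rational number. -/
def principal (q : ℚˣ) : Adeleˣ := Units.map (algebraMap ℚ Adele).toMonoidHom q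

lemma principal_mem (q : ℚˣ) : principal q ∈ principalIdeles := ⟨q, rfl⟩

lemma principal_val (q : ℚˣ) : (principal q).1 = algebraMap ℚ Adele q.1 := rfl

lemma ideleClass_eq_one_iff {j : Adeleˣ} :
    (QuotientGroup.mk (QuotientGroup.mk j : IdeleClassGroup) : IdeleClassModZHat) = 1 ↔
      ∃ q, ∃ u ∈ ZHatUnits, j = principal q * u := by
  rw [QuotientGroup.eq_one_iff, Subgroup.mem_map]
  constructor
  · rintro ⟨u, hu, h⟩
    obtain ⟨q, hq⟩ := QuotientGroup.eq.1 (h : (QuotientGroup.mk u : IdeleClassGroup) = _)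
    exact ⟨q, u, hu, by rw [principal, hq]; rw [mul_comm, mul_inv_cancel_left]⟩
  · rintro ⟨q, u, hu, rfl⟩
    exact ⟨u, hu, QuotientGroup.eq.2 ⟨q, by rw [mul_comm, mul_inv_cancel_right]; rfl⟩⟩

/-- The homomorphism `t ↦ archClass t`. -/
def archClassHom : {t : ℝ // 0 < t} →* IdeleClassModZHat :=
  MonoidHom.mk' archClass fun s t => by
    rw [archClass, archIdele_mul]; rfl

/-- If the idèle of `t` is `q u` with `q` rational, then `q` is a unit of `ZHat`, so multiplication
by `q` preserves `H_1 = ℤ` in both directions and `q = ±1`. Since `q = t > 0`, it is `1`. -/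
lemma archClassHom_injective : Function.Injective archClassHom := by
  refine (injective_iff_map_eq_one archClassHom).2 fun t ht => ?_
  obtain ⟨q, u, hu, h⟩ := ideleClass_eq_one_iff.1 ht
  have harch : t.1 = q.1 := by
    have := congrArg (fun j : Adeleˣ => arch j.1) h
    simp only [Units.val_mul, arch_mul] at this
    rwa [arch_archIdele, arch_of_mem_ZHatUnits hu, mul_one, principal_val, arch_algebraMap] at this
  have hfin : (1 : FiniteAdeleRing ℤ ℚ) = algebraMap ℚ _ q.1 * 1 * u.1.2 := by
    rw [mul_one]
    exact congrArg (fun j : Adeleˣ => j.1.2) h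
  have hmem : ∀ r : ℚ, (∃ n : ℤ, (n : ℚ) = r) ↔ ∃ n : ℤ, (n : ℚ) = r * q.1 := fun r => by
    rw [← mem_ratGroup_one, ← mem_ratGroup_one, ← mem_ratGroup_algebraMap_mul]
    conv_lhs => rw [hfin]
    rw [ratGroup_mul_unit _ hu]
  obtain ⟨m, hm⟩ := (hmem 1).1 ⟨1, by simp⟩
  obtain ⟨n, hn⟩ := (hmem q.1⁻¹).2 ⟨1, by simp⟩
  have hq0 : (0 : ℚ) < q.1 := by
    have := t.2
    rw [harch] at this
    exact_mod_cast this
  have hmn : m * n = 1 := by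
    have : (m : ℚ) * n = 1 := by rw [hm, hn, one_mul, mul_inv_cancel₀ q.ne_zero]
    exact_mod_cast this
  have hm1 : m = 1 := by
    rcases Int.eq_one_or_neg_one_of_mul_eq_one hmn with h | h
    · exact h
    · rw [h] at hm
      norm_num at hm
      linarith
  refine Subtype.ext ?_
  rw [harch, ← one_mul q.1, ← hm, hm1]
  norm_num

lemma archClassHom_surjective : Function.Surjective archClassHom := by
  intro x
  obtain ⟨y, rfl⟩ := QuotientGroup.mk_surjective x
  obtain ⟨j, rfl⟩ := QuotientGroup.mk_surjective y
  obtain ⟨g, hg, u, hu, h⟩ := exists_unit_of_isUnit (MulEquiv.prodUnits j).2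
  have hj0 : arch j.1 ≠ 0 := fun h0 => by
    have := arch_mul j.1 (j⁻¹).1
    rw [j.mul_inv, h0, zero_mul, ← map_one (algebraMap ℚ Adele), arch_algebraMap] at this
    norm_num at this
  -- It suffices to find a rational `q` of the same sign as the archimedean component for which `q`
  -- times the finite part is a unit of `ZHat`: multiplying by `q` then moves everything to the
  -- archimedean place. The finite part is `g u` with `g > 0`, so `q = ± g⁻¹`, with `-1` absorbed in
  -- the unit.
  have key : ∀ (q : ℚˣ), 0 < arch j.1 * (q : ℚ) → (∃ w ∈ ZHatUnits,
      algebraMap ℚ _ (q⁻¹ : ℚˣ).1 * w.1.2 = j.1.2) →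
      ∃ a, archClassHom a = QuotientGroup.mk (QuotientGroup.mk j) := by
    rintro q hpos ⟨w, hw, hwj⟩
    refine ⟨⟨_, hpos⟩, inv_mul_eq_one.1 (ideleClass_eq_one_iff.2 ⟨q⁻¹, w, hw, ?_⟩)⟩
    rw [inv_mul_eq_iff_eq_mul]
    refine Units.ext (adele_ext ?_ ?_)
    · simp only [Units.val_mul, arch_mul, arch_archIdele, principal_val, arch_algebraMap,
        arch_of_mem_ZHatUnits hw]
      rw [mul_one, mul_assoc, ← Rat.cast_mul, Units.mul_inv, Rat.cast_one, mul_one]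
    · rw [← hwj]
      exact (one_mul _).symm
  rcases lt_or_gt_of_ne hj0 with hneg0 | hpos0
  · refine key (-(Units.mk0 g hg.ne')⁻¹) ?_ ?_
    · have : (0 : ℝ) < (g⁻¹ : ℚ) := by exact_mod_cast inv_pos.2 hg
      simp only [Units.val_neg, Units.val_inv_eq_inv_val, Units.val_mk0, Rat.cast_neg]
      nlinarith
    · obtain ⟨u', hu', e⟩ := exists_neg_unit hu
      refine ⟨u', hu', ?_⟩
      rw [e, inv_neg, inv_inv, Units.val_neg, map_neg, neg_mul_neg]
      exact h
  · refine key (Units.mk0 g hg.ne')⁻¹ ?_ ⟨u, hu, by rw [inv_inv]; exact h⟩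
    have : (0 : ℝ) < (g⁻¹ : ℚ) := by exact_mod_cast inv_pos.2 hg
    exact mul_pos hpos0 this

/-- The isomorphism `t ↦ archClass t`. -/
def archClassEquiv : {t : ℝ // 0 < t} ≃* IdeleClassModZHat :=
  MulEquiv.ofBijective archClassHom ⟨archClassHom_injective, archClassHom_surjective⟩

end ArithSite

end

noncomputable section

namespace ArithSite

/-! ## Fibers of points -/

section Fiber

open MonoidalCategory CartesianMonoidalCategory

/-- The representable presheaf on `NTimes`. -/
abbrev repr : NTimesᵒᵖ ⥤ Type := yoneda.obj (SingleObj.star ℕ+)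

/-- The morphism from the representable presheaf given by a section. -/
def ofSection {F : NTimesᵒᵖ ⥤ Type} (s : F.obj (op (SingleObj.star ℕ+))) : repr ⟶ F :=
  yonedaEquiv.symm s

/-- The endomorphism of the representable presheaf given by a positive integer. -/
def reprEnd (k : ℕ+) : repr ⟶ repr :=
  yoneda.map (show SingleObj.star ℕ+ ⟶ SingleObj.star ℕ+ from k)

lemma ofSection_comp {F G : NTimesᵒᵖ ⥤ Type} (s : F.obj (op (SingleObj.star ℕ+))) (g : F ⟶ G) :
    ofSection s ≫ g = ofSection (g.app _ s) :=
  yonedaEquiv.injective (by simp [ofSection, yonedaEquiv_comp])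

lemma reprEnd_comp {F : NTimesᵒᵖ ⥤ Type} (k : ℕ+) (s : F.obj (op (SingleObj.star ℕ+))) :
    reprEnd k ≫ ofSection s = ofSection (F.map (Quiver.Hom.op (V := NTimes)
      (show SingleObj.star ℕ+ ⟶ SingleObj.star ℕ+ from k)) s) :=
  yonedaEquiv_symm_naturality_left _ F s

lemma ofSection_repr (k : ℕ+) :
    ofSection (F := repr) (show SingleObj.star ℕ+ ⟶ SingleObj.star ℕ+ from k) = reprEnd k :=
  yonedaEquiv.symm_apply_eq.2 (yonedaEquiv_yoneda_map _).symm

lemma presheaf_hom_ext {F G : NTimesᵒᵖ ⥤ Type} {f g : F ⟶ G}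
    (h : ∀ s, ofSection s ≫ f = ofSection s ≫ g) : f = g := by
  ext U s
  have := h s
  rw [ofSection_comp, ofSection_comp] at this
  exact yonedaEquiv.symm.injective this

/-- The fiber of a point of the topos of presheaves on `NTimes`. -/
abbrev Fiber (p : ToposPoint NTimes) : Type := p.inverseImage.obj repr

variable {p q : ToposPoint NTimes}

instance : SMul ℕ+ (Fiber p) := ⟨fun k z => p.inverseImage.map (reprEnd k) z⟩

lemma Fiber.smul_def (k : ℕ+) (z : Fiber p) : k • z = p.inverseImage.map (reprEnd k) z := rfl

/-- Compare two maps from `p^*(F)` to `Prop`: the indicator of the elements of this form, and the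
constant `True`. By adjunction they correspond to morphisms out of `F`, which agree once they agree
on every section; there the claim is tautological. -/
lemma exists_section {F : NTimesᵒᵖ ⥤ Type} (t : p.inverseImage.obj F) :
    ∃ (z : Fiber p) (s : F.obj (op (SingleObj.star ℕ+))),
      p.inverseImage.map (ofSection s) z = t := by
  let χ : p.inverseImage.obj F ⟶ Prop := TypeCat.ofHom fun t =>
    ∃ (z : Fiber p) (s : F.obj (op (SingleObj.star ℕ+))), p.inverseImage.map (ofSection s) z = t
  have h : χ = TypeCat.ofHom fun _ => True := by
    apply (p.adj.homEquiv F Prop).injective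
    refine presheaf_hom_ext fun s => ?_
    rw [← Adjunction.homEquiv_naturality_left, ← Adjunction.homEquiv_naturality_left]
    congr 1
    ext z
    exact iff_of_true ⟨z, s, rfl⟩ trivial
  have := ConcreteCategory.congr_hom h t
  exact of_eq_true this

variable (p) in
lemma Fiber.nonempty : Nonempty (Fiber p) :=
  let ⟨z, _⟩ := exists_section (pt p)
  ⟨z⟩

/-- A section of the product of the representable presheaf with itself is a pair of positive
integers, and `(x, y)` comes from such a section. -/
lemma Fiber.directed (x y : Fiber p) : ∃ (z : Fiber p) (k l : ℕ+), x = k • z ∧ y = l • z := by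
  obtain ⟨z, s, hs⟩ := exists_section (tuple p x y)
  refine ⟨z, s.1, s.2, ?_, ?_⟩
  · rw [← map_fst_tuple p x y, ← hs, map_comp_app, ofSection_comp, Fiber.smul_def,
      ← ofSection_repr]
    rfl
  · rw [← map_snd_tuple p x y, ← hs, map_comp_app, ofSection_comp, Fiber.smul_def,
      ← ofSection_repr]
    rfl

/-- Morphisms from the representable presheaf that agree on an element of the fiber are equalized
by an endomorphism that this element factors through. -/
lemma Fiber.exists_equalizing {F : NTimesᵒᵖ ⥤ Type} {f g : repr ⟶ F} {z : Fiber p}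
    (hz : p.inverseImage.map f z = p.inverseImage.map g z) :
    ∃ (m : ℕ+) (w : Fiber p), z = m • w ∧ reprEnd m ≫ f = reprEnd m ≫ g := by
  -- The inverse image preserves the equalizer of `f` and `g`, so `z` lifts to it; the lift comes
  -- from a section of the equalizer, which is a positive integer `m`.
  have hlim := isLimitForkMapOfIsLimit p.inverseImage _ (equalizerIsEqualizer f g)
  obtain ⟨e, he, -⟩ := Types.unique_of_type_equalizer _ _ hlim z hz
  obtain ⟨w, s, rfl⟩ := exists_section e
  have hm : reprEnd ((equalizer.ι f g).app _ s) = ofSection s ≫ equalizer.ι f g := by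
    rw [ofSection_comp, ← ofSection_repr]
  refine ⟨(equalizer.ι f g).app _ s, w, ?_, ?_⟩
  · rw [Fiber.smul_def, hm, ← map_comp_app]
    exact he.symm
  · rw [hm, Category.assoc, Category.assoc, equalizer.condition]

/-! ### The fiber inside the stalk -/

/-- The morphism to the stalk attached to an element of the fiber. -/
def stalkHom (z : Fiber p) : NBar →+* LocalSemiring p where
  toFun s := Stalk.ev z (ofSection (F := under structureSheaf) s)
  map_zero' := (Stalk.ev_zero z).symm ▸ congrArg _ (by ext U k; exact map_zero (NBar.act _))
  map_one' := (Stalk.ev_one z).symm ▸ congrArg _ (by ext U k; exact map_one (NBar.act _))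
  map_add' s t := (Stalk.ev_add z _ _).symm ▸
    congrArg _ (by ext U k; exact map_add (NBar.act _) s t)
  map_mul' s t := (Stalk.ev_mul z _ _).symm ▸
    congrArg _ (by ext U k; exact map_mul (NBar.act _) s t)

lemma stalkHom_apply (z : Fiber p) (s : NBar) :
    stalkHom z s = p.inverseImage.map (ofSection (F := under structureSheaf) s) z := rfl

lemma stalkHom_smul (k : ℕ+) (z : Fiber p) (s : NBar) :
    stalkHom (k • z) s = stalkHom z s ^ (k : ℕ) := by
  rw [← map_pow, stalkHom_apply, stalkHom_apply, Fiber.smul_def, map_comp_app]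
  exact congrArg (fun f => p.inverseImage.map f z)
    (reprEnd_comp (F := under structureSheaf) k s)

lemma NBar.pow_injective (k : ℕ+) : Function.Injective fun s : NBar => s ^ (k : ℕ) := by
  have hk : (k : ℕ) ≠ 0 := k.ne_zero
  have h0 : ∀ n : ℕ, (Tropical.trop (WithTop.some n)) ^ (k : ℕ) =
      Tropical.trop (WithTop.some ((k : ℕ) * n)) := fun n => by
    apply Tropical.untrop_injective
    rw [Tropical.untrop_pow]
    exact (WithTop.coe_nsmul n (k : ℕ)).symm
  have hz : (Tropical.trop (⊤ : WithTop ℕ)) ^ (k : ℕ) = Tropical.trop ⊤ :=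
    zero_pow (M₀ := NBar) hk
  intro s t h
  induction s using Tropical.tropRec with | _ s
  induction t using Tropical.tropRec with | _ t
  simp only at h
  induction s with
  | top =>
    induction t with
    | top => rfl
    | coe n => rw [hz, h0] at h; exact absurd (Tropical.trop_injective h) (WithTop.top_ne_coe)
  | coe m =>
    induction t with
    | top => rw [hz, h0] at h; exact absurd (Tropical.trop_injective h) (WithTop.coe_ne_top)
    | coe n =>
      rw [h0, h0] at h
      have := Nat.eq_of_mul_eq_mul_left k.pos (WithTop.coe_injective (Tropical.trop_injective h))
      rw [this]

/-- Sections with the same image become equal after the action of some `m`, which is the `m`-th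
power and is injective on `NBar`. -/
lemma stalkHom_injective (z : Fiber p) : Function.Injective (stalkHom z) := by
  intro s t h
  obtain ⟨m, w, -, hm⟩ := Fiber.exists_equalizing
    (show p.inverseImage.map (ofSection (F := under structureSheaf) s) z =
      p.inverseImage.map (ofSection (F := under structureSheaf) t) z from h)
  have e := (reprEnd_comp (F := under structureSheaf) m s).symm.trans
    (hm.trans (reprEnd_comp (F := under structureSheaf) m t))
  exact NBar.pow_injective m (yonedaEquiv.symm.injective e)

lemma exists_stalkHom (x : LocalSemiring p) : ∃ (z : Fiber p) (s : NBar), stalkHom z s = x :=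
  exists_section (F := under structureSheaf) x

/-- The embedding of the fiber into the stalk. -/
def fiberEmb (z : Fiber p) : LocalSemiring p := stalkHom z (Tropical.trop 1)

lemma fiberEmb_smul (k : ℕ+) (z : Fiber p) : fiberEmb (k • z) = fiberEmb z ^ (k : ℕ) :=
  stalkHom_smul k z _

lemma trop_one_pow (k : ℕ) : (Tropical.trop 1 : NBar) ^ k = Tropical.trop (k : WithTop ℕ) := by
  apply Tropical.untrop_injective
  rw [Tropical.untrop_pow]
  simp

lemma fiberEmb_smul' (k : ℕ+) (z : Fiber p) :
    fiberEmb (k • z) = stalkHom z (Tropical.trop ((k : ℕ) : WithTop ℕ)) := by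
  rw [fiberEmb_smul, fiberEmb, ← map_pow, trop_one_pow]

lemma Fiber.smul_right_injective (z : Fiber p) {k l : ℕ+} (h : k • z = l • z) : k = l := by
  have := congrArg fiberEmb h
  rw [fiberEmb_smul', fiberEmb_smul'] at this
  exact PNat.coe_injective
    (WithTop.coe_injective (Tropical.trop_injective (stalkHom_injective z this)))

lemma Fiber.mul_smul (k l : ℕ+) (z : Fiber p) : (k * l) • z = k • l • z := by
  rw [Fiber.smul_def, Fiber.smul_def, Fiber.smul_def, map_comp_app]
  exact congrArg (fun f => p.inverseImage.map f z)
    (yoneda.map_comp (X := SingleObj.star ℕ+) (Y := SingleObj.star ℕ+) (Z := SingleObj.star ℕ+) l k)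

lemma Fiber.one_smul (z : Fiber p) : (1 : ℕ+) • z = z := by
  rw [Fiber.smul_def]
  have : reprEnd 1 = 𝟙 _ := yoneda.map_id _
  rw [this, CategoryTheory.Functor.map_id]
  rfl

instance : MulAction ℕ+ (Fiber p) where
  one_smul := Fiber.one_smul
  mul_smul := Fiber.mul_smul

lemma fiberEmb_injective : Function.Injective (fiberEmb (p := p)) := by
  intro x y h
  obtain ⟨z, k, l, rfl, rfl⟩ := Fiber.directed x y
  rw [fiberEmb_smul', fiberEmb_smul'] at h
  rw [PNat.coe_injective
    (WithTop.coe_injective (Tropical.trop_injective (stalkHom_injective z h)))]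

lemma fiberEmb_ne_zero (z : Fiber p) : fiberEmb z ≠ 0 := by
  rw [← map_zero (stalkHom z)]
  exact fun h => WithTop.coe_ne_top (Tropical.trop_injective (stalkHom_injective z h))

lemma fiberEmb_ne_one (z : Fiber p) : fiberEmb z ≠ 1 := by
  rw [← map_one (stalkHom z)]
  exact fun h => one_ne_zero
    (WithTop.coe_injective (Tropical.trop_injective (stalkHom_injective z h)))

/-- The semiring of natural numbers with infinity consists of `∞`, `0` and the positive integers. -/
lemma NBar.cases {motive : NBar → Prop} (zero : motive 0) (one : motive 1)
    (pos : ∀ k : ℕ+, motive (Tropical.trop ((k : ℕ) : WithTop ℕ))) (s : NBar) : motive s := by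
  induction s using Tropical.tropRec with | _ s
  induction s with
  | top => exact zero
  | coe n =>
    rcases Nat.eq_zero_or_pos n with rfl | hn
    · exact one
    · exact pos ⟨n, hn⟩

/-- A section that is neither `∞` nor `0` is a positive integer `k`, and its image at `z` is the
fiber element `k • z`. This is what makes the fiber recoverable from the semiring structure of the
stalk. -/
lemma exists_fiberEmb {x : LocalSemiring p} (h0 : x ≠ 0) (h1 : x ≠ 1) : ∃ z, fiberEmb z = x := by
  obtain ⟨z, s, rfl⟩ := exists_stalkHom x
  induction s using NBar.cases with
  | zero => exact absurd (map_zero _) h0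
  | one => exact absurd (map_one _) h1
  | pos k => exact ⟨k • z, fiberEmb_smul' k z⟩

/-! ## Isomorphisms of points -/

/-- An isomorphism of stalks induces an equivariant bijection of fibers. -/
lemma exists_fiberEquiv (e : LocalSemiring p ≃+* LocalSemiring q) :
    ∃ φ : Fiber p ≃ Fiber q, (∀ (k : ℕ+) z, φ (k • z) = k • φ z) ∧
      ∀ z, fiberEmb (φ z) = e (fiberEmb z) := by
  have h1 : ∀ z : Fiber p, ∃ w : Fiber q, fiberEmb w = e (fiberEmb z) := fun z =>
    exists_fiberEmb (e.map_ne_zero_iff.2 (fiberEmb_ne_zero z))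
      (e.map_ne_one_iff.2 (fiberEmb_ne_one z))
  have h2 : ∀ z : Fiber q, ∃ w : Fiber p, fiberEmb w = e.symm (fiberEmb z) := fun z =>
    exists_fiberEmb (e.symm.map_ne_zero_iff.2 (fiberEmb_ne_zero z))
      (e.symm.map_ne_one_iff.2 (fiberEmb_ne_one z))
  choose f hf using h1
  choose g hg using h2
  refine ⟨⟨f, g, fun z => fiberEmb_injective ?_, fun z => fiberEmb_injective ?_⟩,
    fun k z => fiberEmb_injective ?_, hf⟩
  · rw [hg, hf, e.symm_apply_apply]
  · rw [hf, hg, e.apply_symm_apply]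
  · change fiberEmb (f _) = fiberEmb (k • f z)
    rw [hf, fiberEmb_smul, fiberEmb_smul, map_pow, hf]

/-- Such a coincidence is always witnessed by relations `y = k • x`, `z = l • x`, `x = m • w` in the
fiber and an identity of morphisms of presheaves; an equivariant map preserves these. Hence
`fiberTransform` does not depend on its choices. -/
lemma map_ofSection_eq_of_equivariant {φ : Fiber p → Fiber q}
    (hφ : ∀ (k : ℕ+) z, φ (k • z) = k • φ z) {F : NTimesᵒᵖ ⥤ Type} {f g : repr ⟶ F}
    {y z : Fiber p} (h : p.inverseImage.map f y = p.inverseImage.map g z) :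
    q.inverseImage.map f (φ y) = q.inverseImage.map g (φ z) := by
  obtain ⟨x, k, l, rfl, rfl⟩ := Fiber.directed y z
  rw [Fiber.smul_def, Fiber.smul_def, map_comp_app, map_comp_app] at h
  obtain ⟨m, w, rfl, hm⟩ := Fiber.exists_equalizing h
  rw [hφ, hφ, hφ, hφ, Fiber.smul_def k, Fiber.smul_def l, map_comp_app, map_comp_app,
    Fiber.smul_def m, map_comp_app, map_comp_app, hm]

/-- The morphism of points induced by an equivariant map of fibers. -/
def fiberTransform (φ : Fiber p → Fiber q) (hφ : ∀ (k : ℕ+) z, φ (k • z) = k • φ z) :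
    p.inverseImage ⟶ q.inverseImage where
  app F := TypeCat.ofHom fun t => q.inverseImage.map
    (ofSection (exists_section t).choose_spec.choose) (φ (exists_section t).choose)
  naturality F G g := by
    ext t
    change q.inverseImage.map _ _ = q.inverseImage.map g (q.inverseImage.map _ _)
    rw [map_comp_app]
    refine map_ofSection_eq_of_equivariant hφ ?_
    rw [(exists_section (p.inverseImage.map g t)).choose_spec.choose_spec, ← map_comp_app,
      (exists_section t).choose_spec.choose_spec]

lemma fiberTransform_app {φ : Fiber p → Fiber q} (hφ : ∀ (k : ℕ+) z, φ (k • z) = k • φ z)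
    {F : NTimesᵒᵖ ⥤ Type} (s : F.obj (op (SingleObj.star ℕ+))) (z : Fiber p) :
    (fiberTransform φ hφ).app F (p.inverseImage.map (ofSection s) z) =
      q.inverseImage.map (ofSection s) (φ z) :=
  map_ofSection_eq_of_equivariant hφ (exists_section _).choose_spec.choose_spec

lemma fiberTransform_comp {r : ToposPoint NTimes} {φ : Fiber p → Fiber q} {ψ : Fiber q → Fiber r}
    (hφ : ∀ (k : ℕ+) z, φ (k • z) = k • φ z) (hψ : ∀ (k : ℕ+) z, ψ (k • z) = k • ψ z)
    {F : NTimesᵒᵖ ⥤ Type} (s : F.obj (op (SingleObj.star ℕ+))) (z : Fiber p) :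
    (fiberTransform φ hφ ≫ fiberTransform ψ hψ).app F (p.inverseImage.map (ofSection s) z) =
      r.inverseImage.map (ofSection s) (ψ (φ z)) := by
  change (fiberTransform ψ hψ).app F ((fiberTransform φ hφ).app F _) = _
  rw [fiberTransform_app, fiberTransform_app]

/-- The isomorphism of points induced by an equivariant bijection of fibers. -/
def fiberIso (φ : Fiber p ≃ Fiber q) (hφ : ∀ (k : ℕ+) z, φ (k • z) = k • φ z) :
    p.inverseImage ≅ q.inverseImage where
  hom := fiberTransform φ hφ
  inv := fiberTransform φ.symm fun k z => φ.injective (by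
    rw [hφ, φ.apply_symm_apply, φ.apply_symm_apply])
  hom_inv_id := by
    ext F t
    obtain ⟨z, s, rfl⟩ := exists_section t
    refine (fiberTransform_comp _ _ s z).trans ?_
    rw [φ.symm_apply_apply]
    rfl
  inv_hom_id := by
    ext F t
    obtain ⟨z, s, rfl⟩ := exists_section t
    refine (fiberTransform_comp _ _ s z).trans ?_
    rw [φ.apply_symm_apply]
    rfl

/-- Every isomorphism of stalks is induced by an isomorphism of points. -/
lemma exists_iso_of_stalkEquiv (e : LocalSemiring p ≃+* LocalSemiring q) :
    ∃ α : p.inverseImage ≅ q.inverseImage, ∀ s : LocalSemiring p, Stalk.map α.hom s = e s := by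
  obtain ⟨φ, hφ, hφe⟩ := exists_fiberEquiv e
  refine ⟨fiberIso φ hφ, fun x => ?_⟩
  obtain ⟨z, s, rfl⟩ := exists_stalkHom x
  refine (fiberTransform_app hφ (F := under structureSheaf) s z).trans ?_
  change stalkHom (φ z) s = _
  induction s using NBar.cases with
  | zero => rw [map_zero, map_zero, map_zero]
  | one => rw [map_one, map_one, map_one]
  | pos k => rw [← fiberEmb_smul', ← fiberEmb_smul', ← hφ, hφe]

lemma Stalk.map_ev (α : p.inverseImage ⟶ q.inverseImage) {W : NTimesᵒᵖ ⥤ Type}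
    (w : p.inverseImage.obj W) (f : W ⟶ under structureSheaf) :
    Stalk.map α (Stalk.ev w f) = Stalk.ev (α.app W w) f :=
  ConcreteCategory.congr_hom (α.naturality f) w

/-- The isomorphism of stalks induced by an isomorphism of points. -/
def stalkEquiv (α : p.inverseImage ≅ q.inverseImage) : LocalSemiring p ≃+* LocalSemiring q where
  toFun := Stalk.map α.hom
  invFun := Stalk.map α.inv
  left_inv x := ConcreteCategory.congr_hom (α.hom_inv_id_app (under structureSheaf)) x
  right_inv x := ConcreteCategory.congr_hom (α.inv_hom_id_app (under structureSheaf)) x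
  map_mul' x y := Stalk.induct (P := fun x y _ => Stalk.map α.hom (x * y) =
      Stalk.map α.hom x * Stalk.map α.hom y) (fun W w f g h => by
    rw [Stalk.ev_mul, Stalk.map_ev, Stalk.map_ev, Stalk.map_ev, Stalk.ev_mul]) x y y
  map_add' x y := Stalk.induct (P := fun x y _ => Stalk.map α.hom (x + y) =
      Stalk.map α.hom x + Stalk.map α.hom y) (fun W w f g h => by
    rw [Stalk.ev_add, Stalk.map_ev, Stalk.map_ev, Stalk.map_ev, Stalk.ev_add]) x y y

/-! ## The stalk as the semiring of nonnegative elements of a subgroup of `ℚ` -/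

/-- An equivariant identification of the fiber with the positive part of a subgroup of `ℚ`. -/
structure FiberCoord (p : ToposPoint NTimes) (H : AddSubgroup ℚ) where
  toFun : Fiber p → ℚ
  smul (k : ℕ+) (z : Fiber p) : toFun (k • z) = (k : ℕ) * toFun z
  pos (z : Fiber p) : 0 < toFun z
  mem (z : Fiber p) : toFun z ∈ H
  exists_eq (h : ℚ) (hH : h ∈ H) (hh : 0 < h) : ∃ z, toFun z = h

namespace FiberCoord

variable {H : AddSubgroup ℚ} (c : FiberCoord p H)

/-- The coordinate of an element of the fiber, as a nonnegative element of the subgroup. -/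
def val (z : Fiber p) : {h : H // 0 ≤ h} := ⟨⟨c.toFun z, c.mem z⟩, (c.pos z).le⟩

lemma val_pos (z : Fiber p) : 0 < c.val z := c.pos z

lemma val_smul (k : ℕ+) (z : Fiber p) : c.val (k • z) = (k : ℕ) • c.val z := by
  refine Subtype.ext (Subtype.ext ?_)
  change c.toFun (k • z) = (k : ℕ) • c.toFun z
  rw [c.smul, nsmul_eq_mul]

/-- The morphism to the semiring of nonnegative elements of the subgroup attached to an element of
the fiber. -/
def semiringHom (z : Fiber p) : NBar →+* NonnegSemiring H where
  toFun s := Tropical.trop ((Tropical.untrop s).map fun n => n • c.val z)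
  map_zero' := rfl
  map_one' := by
    apply Tropical.untrop_injective
    exact congrArg WithTop.some (zero_nsmul (c.val z))
  map_add' s t := by
    apply Tropical.untrop_injective
    have hmono : Monotone (WithTop.map fun n : ℕ => n • c.val z) :=
      Monotone.withTop_map fun m n h => nsmul_le_nsmul_left (c.val_pos z).le h
    exact hmono.map_min
  map_mul' s t := by
    apply Tropical.untrop_injective
    exact WithTop.map_add (multiplesHom _ (c.val z)) (Tropical.untrop s) (Tropical.untrop t)

lemma semiringHom_smul (k : ℕ+) (z : Fiber p) (s : NBar) :
    c.semiringHom (k • z) s = c.semiringHom z s ^ (k : ℕ) := by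
  rw [← map_pow]
  induction s using NBar.cases with
  | zero => rw [zero_pow k.ne_zero, map_zero, map_zero]
  | one => rw [one_pow, map_one, map_one]
  | pos m =>
    rw [← trop_one_pow, ← pow_mul, mul_comm, pow_mul, map_pow, map_pow]
    congr 1
    rw [trop_one_pow]
    apply Tropical.untrop_injective
    change WithTop.some (1 • c.val (k • z)) = WithTop.some ((k : ℕ) • c.val z)
    rw [one_nsmul, c.val_smul]

lemma semiringHom_injective (z : Fiber p) : Function.Injective (c.semiringHom z) := by
  intro s t h
  have hinj : Function.Injective fun n : ℕ => n • c.val z := fun m n h =>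
    (nsmul_left_strictMono (c.val_pos z)).injective h
  exact Tropical.untrop_injective
    (WithTop.map_injective hinj (Tropical.trop_injective h))

lemma exists_semiringHom (x : NonnegSemiring H) : ∃ z s, c.semiringHom z s = x := by
  induction x using Tropical.tropRec with | _ x
  induction x with
  | top =>
    obtain ⟨z⟩ := Fiber.nonempty p
    exact ⟨z, 0, map_zero _⟩
  | coe x =>
    rcases x.2.eq_or_lt with hx | hx
    · obtain ⟨z⟩ := Fiber.nonempty p
      refine ⟨z, 1, (map_one _).trans ?_⟩
      exact congrArg (fun h : {h : H // 0 ≤ h} => Tropical.trop (WithTop.some h)) (Subtype.ext hx)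
    · obtain ⟨z, hz⟩ := c.exists_eq x.1 x.1.2 hx
      refine ⟨z, Tropical.trop (WithTop.some 1), ?_⟩
      apply Tropical.untrop_injective
      change WithTop.some (1 • c.val z) = WithTop.some x
      rw [one_nsmul]
      exact congrArg WithTop.some (Subtype.ext (Subtype.ext hz))

end FiberCoord

/-- A semiring covered by compatible embeddings of `NBar` indexed by the fiber is determined up to
isomorphism. -/
lemma nonempty_ringEquiv_of_charts {M N : Type} [CommSemiring M] [CommSemiring N]
    (f : Fiber p → NBar →+* M) (g : Fiber p → NBar →+* N)
    (f_smul : ∀ (k : ℕ+) z s, f (k • z) s = f z s ^ (k : ℕ))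
    (g_smul : ∀ (k : ℕ+) z s, g (k • z) s = g z s ^ (k : ℕ))
    (f_inj : ∀ z, Function.Injective (f z)) (g_inj : ∀ z, Function.Injective (g z))
    (f_surj : ∀ x, ∃ z s, f z s = x) (g_surj : ∀ x, ∃ z s, g z s = x) :
    Nonempty (M ≃+* N) := by
  have common : ∀ x y : M, ∃ z s t, f z s = x ∧ f z t = y := fun x y => by
    obtain ⟨z, s, rfl⟩ := f_surj x
    obtain ⟨w, t, rfl⟩ := f_surj y
    obtain ⟨u, k, l, rfl, rfl⟩ := Fiber.directed z w
    exact ⟨u, s ^ (k : ℕ), t ^ (l : ℕ), by rw [map_pow, f_smul], by rw [map_pow, f_smul]⟩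
  -- Over a common divisor `u` of `z` and `w`, both equalities reduce by injectivity to the same
  -- equality in `NBar`.
  have compat : ∀ z w s t, f z s = f w t ↔ g z s = g w t := fun z w s t => by
    obtain ⟨u, k, l, rfl, rfl⟩ := Fiber.directed z w
    rw [f_smul, f_smul, g_smul, g_smul, ← map_pow, ← map_pow, ← map_pow, ← map_pow,
      (f_inj u).eq_iff, (g_inj u).eq_iff]
  choose zf sf hf using f_surj
  have spec : ∀ z s, g (zf (f z s)) (sf (f z s)) = g z s := fun z s =>
    (compat _ _ _ _).1 (hf _)
  obtain ⟨z₀⟩ := Fiber.nonempty p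
  let e : M →+* N :=
    { toFun := fun x => g (zf x) (sf x)
      map_zero' := by rw [← map_zero (f z₀), spec, map_zero]
      map_one' := by rw [← map_one (f z₀), spec, map_one]
      map_add' := fun x y => by
        obtain ⟨z, s, t, rfl, rfl⟩ := common x y
        rw [← map_add, spec, spec, spec, map_add]
      map_mul' := fun x y => by
        obtain ⟨z, s, t, rfl, rfl⟩ := common x y
        rw [← map_mul, spec, spec, spec, map_mul] }
  refine ⟨RingEquiv.ofBijective e ⟨fun x y h => ?_, fun y => ?_⟩⟩
  · rw [← hf x, ← hf y]
    exact (compat _ _ _ _).2 h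
  · obtain ⟨z, s, rfl⟩ := g_surj y
    exact ⟨f z s, spec z s⟩

lemma FiberCoord.nonempty_ringEquiv {H : AddSubgroup ℚ} (c : FiberCoord p H) :
    Nonempty (NonnegSemiring H ≃+* LocalSemiring p) :=
  nonempty_ringEquiv_of_charts c.semiringHom stalkHom c.semiringHom_smul stalkHom_smul
    c.semiringHom_injective stalkHom_injective c.exists_semiringHom exists_stalkHom

lemma FiberCoord.ne_bot {H : AddSubgroup ℚ} (c : FiberCoord p H) : H ≠ ⊥ := fun h => by
  obtain ⟨z⟩ := Fiber.nonempty p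
  exact (c.pos z).ne' ((AddSubgroup.eq_bot_iff_forall H).1 h _ (c.mem z))

/-! ### Fibers as positive parts of subgroups of `ℚ` -/

variable (p) in
-- Fix `x`; if `x = k • z` and `y = l • z`, the coordinate of `y` is `l / k`. Directedness and
-- freeness make it independent of `z`. Directedness also makes the integer multiples of coordinates
-- a subgroup.
lemma exists_fiberCoord : ∃ H, Nonempty (FiberCoord p H) := by
  obtain ⟨x⟩ := Fiber.nonempty p
  have hex : ∀ y : Fiber p, ∃ r : ℚ, ∀ (z : Fiber p) (k l : ℕ+), x = k • z → y = l • z →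
      r = (l : ℕ) / (k : ℕ) := fun y => by
    obtain ⟨z, k, l, hk, hl⟩ := Fiber.directed x y
    refine ⟨(l : ℕ) / (k : ℕ), fun w m n hm hn => ?_⟩
    obtain ⟨u, a, b, rfl, rfl⟩ := Fiber.directed z w
    have h1 : k * a = m * b := by
      apply Fiber.smul_right_injective u
      rw [mul_smul, mul_smul, ← hk, ← hm]
    have h2 : l * a = n * b := by
      apply Fiber.smul_right_injective u
      rw [mul_smul, mul_smul, ← hl, ← hn]
    have h1' : ((k : ℕ) : ℚ) * (a : ℕ) = (m : ℕ) * (b : ℕ) := by exact_mod_cast congrArg PNat.val h1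
    have h2' : ((l : ℕ) : ℚ) * (a : ℕ) = (n : ℕ) * (b : ℕ) := by exact_mod_cast congrArg PNat.val h2
    have pos : ∀ k : ℕ+, ((k : ℕ) : ℚ) ≠ 0 := fun k => by exact_mod_cast k.ne_zero
    rw [div_eq_div_iff (pos k) (pos m)]
    apply mul_right_cancel₀ (mul_ne_zero (pos a) (pos b))
    linear_combination (m : ℕ) * (b : ℕ) * h2' - (n : ℕ) * (b : ℕ) * h1'
  choose t ht using hex
  have t_smul : ∀ (k : ℕ+) z, t (k • z) = (k : ℕ) * t z := fun k z => by
    obtain ⟨u, a, b, ha, rfl⟩ := Fiber.directed x z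
    rw [ht _ u a b ha rfl, ht _ u a (k * b) ha (mul_smul k b u).symm, PNat.mul_coe, Nat.cast_mul,
      mul_div_assoc]
  have t_pos : ∀ z, 0 < t z := fun z => by
    obtain ⟨u, a, b, ha, hb⟩ := Fiber.directed x z
    rw [ht _ u a b ha hb]
    exact div_pos (by exact_mod_cast b.pos) (by exact_mod_cast a.pos)
  let H : AddSubgroup ℚ :=
    { carrier := {q | ∃ (z : Fiber p) (k : ℤ), q = k * t z}
      zero_mem' := ⟨x, 0, by simp⟩
      neg_mem' := by
        rintro _ ⟨z, k, rfl⟩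
        exact ⟨z, -k, by push_cast; ring⟩
      add_mem' := by
        rintro _ _ ⟨z, k, rfl⟩ ⟨w, l, rfl⟩
        obtain ⟨u, a, b, rfl, rfl⟩ := Fiber.directed z w
        exact ⟨u, k * (a : ℕ) + l * (b : ℕ), by rw [t_smul, t_smul]; push_cast; ring⟩ }
  refine ⟨H, ⟨⟨t, t_smul, t_pos, fun z => ⟨z, 1, by simp⟩, ?_⟩⟩⟩
  rintro _ ⟨z, k, rfl⟩ hk
  have hk : 0 < k := by exact_mod_cast pos_of_mul_pos_left hk (t_pos z).le
  lift k to ℕ using hk.le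
  refine ⟨Nat.toPNat k (by exact_mod_cast hk) • z, ?_⟩
  rw [t_smul]
  rfl

end Fiber

end ArithSite

end

noncomputable section

namespace ArithSite

/-! ## The point attached to a subgroup of `ℚ` -/

/-- The positive integer underlying a morphism of `NTimes`. -/
def homVal {x y : NTimes} (f : x ⟶ y) : ℕ+ := f

/-- The functor on `NTimes` given by the positive elements of a subgroup of `ℚ`. -/
def positivePart (H : AddSubgroup ℚ) : NTimes ⥤ Type where
  obj _ := {h : ℚ // h ∈ H ∧ 0 < h}
  map k := TypeCat.ofHom fun h => ⟨((homVal k : ℕ) : ℚ) * h.1,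
    by rw [← nsmul_eq_mul]; exact H.nsmul_mem h.2.1 _,
    mul_pos (by exact_mod_cast (homVal k).pos) h.2.2⟩
  map_id _ := by
    ext h
    change ((1 : ℕ+) : ℕ) * h.1 = h.1
    simp
  map_comp k l := by
    ext h
    change ((homVal l * homVal k : ℕ+) : ℕ) * h.1 = (homVal l : ℕ) * ((homVal k : ℕ) * h.1)
    rw [PNat.mul_coe, Nat.cast_mul, mul_assoc]

/-- Over a common denominator `d` the two elements are `a / d` and `b / d`; by Bézout, `gcd a b / d`
lies in `H`. -/
lemma exists_common_divisor (H : AddSubgroup ℚ) {x y : ℚ} (hx : x ∈ H) (hy : y ∈ H) (hx0 : 0 < x)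
    (hy0 : 0 < y) : ∃ w ∈ H, 0 < w ∧ ∃ k l : ℕ+, ((k : ℕ) : ℚ) * w = x ∧ ((l : ℕ) : ℚ) * w = y := by
  obtain ⟨a, b, d, ha, hb, hd, rfl, rfl⟩ : ∃ a b d : ℕ, 0 < a ∧ 0 < b ∧ 0 < d ∧
      (a : ℚ) / d = x ∧ (b : ℚ) / d = y := by
    have hx1 := Rat.num_pos.2 hx0
    have hy1 := Rat.num_pos.2 hy0
    have e : ∀ z : ℚ, 0 < z → ((z.num.toNat : ℕ) : ℚ) = z * z.den := fun z hz => by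
      rw [Rat.mul_den_eq_num]
      exact_mod_cast Int.toNat_of_nonneg (Rat.num_pos.2 hz).le
    refine ⟨x.num.toNat * y.den, y.num.toNat * x.den, x.den * y.den,
      Nat.mul_pos (by omega) y.den_pos, Nat.mul_pos (by omega) x.den_pos,
      Nat.mul_pos x.den_pos y.den_pos, ?_, ?_⟩ <;>
    · push_cast
      rw [e _ ‹_›]
      have := x.den_ne_zero
      have := y.den_ne_zero
      field_simp
  have hg : 0 < a.gcd b := Nat.gcd_pos_of_pos_left _ ha
  have hd' : (d : ℚ) ≠ 0 := by exact_mod_cast hd.ne'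
  have hg' : ((a.gcd b : ℕ) : ℚ) ≠ 0 := by exact_mod_cast hg.ne'
  refine ⟨(a.gcd b : ℕ) / d, ?_, div_pos (by exact_mod_cast hg) (by exact_mod_cast hd),
    Nat.toPNat _ (Nat.div_pos (Nat.le_of_dvd ha (Nat.gcd_dvd_left a b)) hg),
    Nat.toPNat _ (Nat.div_pos (Nat.le_of_dvd hb (Nat.gcd_dvd_right a b)) hg), ?_, ?_⟩
  · have : ((a.gcd b : ℕ) : ℚ) / d = a.gcdA b • ((a : ℚ) / d) + a.gcdB b • ((b : ℚ) / d) := by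
      have h := congrArg (Int.cast : ℤ → ℚ) (Nat.gcd_eq_gcd_ab a b)
      push_cast at h
      rw [h, zsmul_eq_mul, zsmul_eq_mul]
      ring
    rw [this]
    exact H.add_mem (H.zsmul_mem hx _) (H.zsmul_mem hy _)
  · change ((a / a.gcd b : ℕ) : ℚ) * _ = _
    rw [Nat.cast_div (Nat.gcd_dvd_left a b) hg']
    field_simp
  · change ((b / a.gcd b : ℕ) : ℚ) * _ = _
    rw [Nat.cast_div (Nat.gcd_dvd_right a b) hg']
    field_simp

/-- The element of the category of elements given by a positive element of the subgroup. -/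
def positiveElement {H : AddSubgroup ℚ} (h : ℚ) (hH : h ∈ H) (h0 : 0 < h) :
    (positivePart H).Elements :=
  ⟨SingleObj.star ℕ+, ⟨h, hH, h0⟩⟩

lemma hom_val_mul {H : AddSubgroup ℚ} {x y : (positivePart H).Elements} (f : x ⟶ y) :
    ((homVal f.1 : ℕ) : ℚ) * x.2.1 = y.2.1 :=
  congrArg Subtype.val f.2

/-- Common divisors give the cones; parallel arrows coincide because a positive rational can be
cancelled. This is the flatness that makes the inverse image below left exact. -/
lemma isCofiltered_elements {H : AddSubgroup ℚ} (hH : H ≠ ⊥) :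
    IsCofiltered (positivePart H).Elements where
  nonempty := by
    obtain ⟨h, hh, h0⟩ := exists_ne_zero_of_ne_bot hH
    rcases lt_or_gt_of_ne h0 with h1 | h1
    · exact ⟨positiveElement (-h) (H.neg_mem hh) (neg_pos.2 h1)⟩
    · exact ⟨positiveElement h hh h1⟩
  cone_objs x y := by
    obtain ⟨w, hw, hw0, k, l, hk, hl⟩ :=
      exists_common_divisor H x.2.2.1 y.2.2.1 x.2.2.2 y.2.2.2
    exact ⟨positiveElement w hw hw0, ⟨k, Subtype.ext hk⟩, ⟨l, Subtype.ext hl⟩, trivial⟩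
  cone_maps x y f g := by
    refine ⟨x, 𝟙 x, ?_⟩
    have h := (hom_val_mul f).trans (hom_val_mul g).symm
    have : f = g := by
      refine CategoryOfElements.ext _ _ _ ?_
      have := mul_right_cancel₀ x.2.2.2.ne' h
      exact PNat.coe_injective (Nat.cast_injective this)
    rw [this]

/-- The point of the topos attached to a nontrivial subgroup of `ℚ`. -/
def subgroupPoint (H : AddSubgroup ℚ) (hH : H ≠ ⊥) : ToposPoint NTimes where
  -- This is the tensor product with `positivePart H`, written as a colimit over the opposite of its
  -- category of elements. That category is filtered, so the colimit commutes with finite limits.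
  inverseImage := (Functor.whiskeringLeft _ _ Type).obj
    (CategoryOfElements.π (positivePart H)).op ⋙ colim
  directImage := Functor.const _ ⋙ (CategoryOfElements.π (positivePart H)).op.ran
  adj := ((CategoryOfElements.π (positivePart H)).op.ranAdjunction Type).comp colimConstAdj
  preservesFiniteLimits := by
    have := isCofiltered_elements hH
    infer_instance

section

variable {H : AddSubgroup ℚ} {hH : H ≠ ⊥}

/-- The diagram whose colimit is the fiber of the point attached to a subgroup of `ℚ`. -/
abbrev fiberDiagram (H : AddSubgroup ℚ) : (positivePart H).Elementsᵒᵖ ⥤ Type :=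
  (CategoryOfElements.π (positivePart H)).op ⋙ repr

/-- The element of the fiber given by a multiple of a positive element of the subgroup. -/
def fiberMk (x : (positivePart H).Elements) (k : ℕ+) : Fiber (subgroupPoint H hH) :=
  colimit.ι (fiberDiagram H) (op x) k

lemma exists_fiberMk (t : Fiber (subgroupPoint H hH)) : ∃ x k, fiberMk x k = t := by
  obtain ⟨x, k, h⟩ := Types.jointly_surjective' (F := fiberDiagram H) t
  exact ⟨x.unop, k, h⟩

lemma smul_fiberMk (k l : ℕ+) (x : (positivePart H).Elements) :
    l • fiberMk (hH := hH) x k = fiberMk x (l * k) :=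
  ConcreteCategory.congr_hom (ι_colimMap (F := fiberDiagram H) (G := fiberDiagram H)
    (Functor.whiskerLeft (CategoryOfElements.π (positivePart H)).op (reprEnd l)) (op x)) k

/-- The value of a multiple of a positive element of the subgroup. -/
def fiberVal : Fiber (subgroupPoint H hH) → ℚ :=
  colimit.desc (fiberDiagram H)
    { pt := ℚ
      ι :=
        { app := fun x => TypeCat.ofHom fun k => ((homVal k : ℕ) : ℚ) * x.unop.2.1
          naturality := fun x y f => by
            ext k
            change (((homVal k : ℕ+) * homVal f.unop.1 : ℕ+) : ℕ) * y.unop.2.1 =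
              ((homVal k : ℕ) : ℚ) * x.unop.2.1
            rw [← hom_val_mul f.unop, PNat.mul_coe]
            push_cast
            ring } }

lemma fiberVal_mk (x : (positivePart H).Elements) (k : ℕ+) :
    fiberVal (fiberMk (hH := hH) x k) = (k : ℕ) * x.2.1 :=
  ConcreteCategory.congr_hom (colimit.ι_desc (F := fiberDiagram H) _ (op x)) k

/-- The fiber of the point attached to a subgroup of `ℚ` is the positive part of the subgroup. -/
def subgroupPointCoord (H : AddSubgroup ℚ) (hH : H ≠ ⊥) : FiberCoord (subgroupPoint H hH) H where
  toFun := fiberVal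
  smul k z := by
    obtain ⟨x, l, rfl⟩ := exists_fiberMk z
    rw [smul_fiberMk, fiberVal_mk, fiberVal_mk, PNat.mul_coe, Nat.cast_mul, mul_assoc]
  pos z := by
    obtain ⟨x, l, rfl⟩ := exists_fiberMk z
    rw [fiberVal_mk]
    exact mul_pos (by exact_mod_cast l.pos) x.2.2.2
  mem z := by
    obtain ⟨x, l, rfl⟩ := exists_fiberMk z
    rw [fiberVal_mk, ← nsmul_eq_mul]
    exact H.nsmul_mem x.2.2.1 _
  exists_eq h hh h0 := ⟨fiberMk (positiveElement h hh h0) 1, by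
    rw [fiberVal_mk]
    exact (congrArg (· * h) Nat.cast_one).trans (one_mul h)⟩

end

end ArithSite

end

noncomputable section

namespace ArithSite

open IsDedekindDomain NumberField

/-! ## Morphisms from `NonnegSemiring H` -/

section Nonneg

variable {H K : AddSubgroup ℚ}

/-- The element of `NonnegSemiring H` given by a nonnegative element of `H`. -/
def finiteElt (h : {h : H // 0 ≤ h}) : NonnegSemiring H := Tropical.trop (WithTop.some h)

lemma finiteElt_injective : Function.Injective (finiteElt (H := H)) := fun _ _ h =>
  WithTop.coe_injective (Tropical.trop_injective h)

lemma finiteElt_zero : finiteElt (0 : {h : H // 0 ≤ h}) = 1 := rfl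

lemma finiteElt_add (h k : {h : H // 0 ≤ h}) : finiteElt (h + k) = finiteElt h * finiteElt k := rfl

lemma finiteElt_ne_zero (h : {h : H // 0 ≤ h}) : finiteElt h ≠ 0 := fun e =>
  WithTop.coe_ne_top (Tropical.trop_injective e)

lemma finiteElt_nsmul (n : ℕ) (h : {h : H // 0 ≤ h}) : finiteElt (n • h) = finiteElt h ^ n := by
  induction n with
  | zero => rw [zero_nsmul, pow_zero, finiteElt_zero]
  | succ n ih => rw [succ_nsmul, finiteElt_add, ih, pow_succ]

lemma NonnegSemiring.cases {motive : NonnegSemiring H → Prop} (zero : motive 0)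
    (finite : ∀ h, motive (finiteElt h)) (x : NonnegSemiring H) : motive x := by
  induction x using Tropical.tropRec with | _ x
  induction x with
  | top => exact zero
  | coe h => exact finite h

lemma exists_nonneg_of_ne_bot (hH : H ≠ ⊥) : ∃ h : {h : H // 0 ≤ h}, (0 : ℚ) < h.1.1 := by
  obtain ⟨h, hh, h0⟩ := exists_ne_zero_of_ne_bot hH
  exact ⟨⟨⟨|h|, by rcases abs_choice h with e | e <;> rw [e]; exacts [hh, H.neg_mem hh]⟩,
    abs_nonneg h⟩, abs_pos.2 h0⟩

lemma nonneg_coe_nsmul (n : ℕ) (h : {h : H // 0 ≤ h}) : (n • h).1.1 = n * h.1.1 :=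
  nsmul_eq_mul n h.1.1

lemma exists_nsmul_eq_nsmul {h k : {h : H // 0 ≤ h}} (hh : (0 : ℚ) < h.1.1)
    (hk : (0 : ℚ) < k.1.1) : ∃ m n : ℕ+, (m : ℕ) • h = (n : ℕ) • k := by
  obtain ⟨w, -, -, a, b, ha, hb⟩ := exists_common_divisor H h.1.2 k.1.2 hh hk
  refine ⟨b, a, Subtype.ext (Subtype.ext ?_)⟩
  rw [nonneg_coe_nsmul, nonneg_coe_nsmul, ← ha, ← hb]
  ring

lemma eq_zero_of_coe {h : {h : H // 0 ≤ h}} (hh : h.1.1 = 0) : h = 0 :=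
  Subtype.ext (Subtype.ext hh)

lemma isUnit_iff_eq_one {x : NonnegSemiring H} : IsUnit x ↔ x = 1 := by
  refine ⟨fun hx => ?_, fun hx => hx ▸ isUnit_one⟩
  obtain ⟨y, hxy⟩ := isUnit_iff_exists_inv.1 hx
  induction x using NonnegSemiring.cases with
  | zero => exact absurd hxy (by rw [zero_mul]; exact (finiteElt_ne_zero (0 : {h : H // 0 ≤ h})).symm)
  | finite h =>
    induction y using NonnegSemiring.cases with
    | zero =>
      exact absurd hxy (by rw [mul_zero]; exact (finiteElt_ne_zero (0 : {h : H // 0 ≤ h})).symm)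
    | finite k =>
      have e : h + k = 0 := finiteElt_injective hxy
      have e' : h.1.1 + k.1.1 = 0 := congrArg (fun x : {h : H // 0 ≤ h} => x.1.1) e
      have h1 : 0 ≤ h.1.1 := h.2
      have h2 : 0 ≤ k.1.1 := k.2
      rw [eq_zero_of_coe (h := h) (by linarith), finiteElt_zero]

/-! ### Scalings, and isomorphisms as scalings -/

/-- Multiplication by a positive rational number, as a morphism of semirings. -/
def scaleHom (q : ℚ) (hq : 0 < q) (h : ∀ x ∈ H, q * x ∈ K) :
    NonnegSemiring H →+* NonnegSemiring K :=
  let g : {h : H // 0 ≤ h} →+ {k : K // 0 ≤ k} :=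
    { toFun := fun x => ⟨⟨q * x.1.1, h _ x.1.2⟩, mul_nonneg hq.le x.2⟩
      map_zero' := eq_zero_of_coe (mul_zero q)
      map_add' := fun _ _ => Subtype.ext (Subtype.ext (mul_add q _ _)) }
  have hg : Monotone g := fun _ _ hxy =>
    mul_le_mul_of_nonneg_left (α := ℚ) hxy hq.le
  { toFun := fun s => Tropical.trop ((Tropical.untrop s).map g)
    map_zero' := rfl
    map_one' := congrArg finiteElt g.map_zero
    map_add' := fun _ _ => Tropical.untrop_injective (Monotone.withTop_map hg).map_min
    map_mul' := fun s t =>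
      Tropical.untrop_injective (WithTop.map_add g (Tropical.untrop s) (Tropical.untrop t)) }

/-- Multiplication by a positive rational number, as an isomorphism of semirings. -/
def scaleEquiv (q : ℚ) (hq : 0 < q) (h : ∀ x, x ∈ H ↔ q * x ∈ K) :
    NonnegSemiring H ≃+* NonnegSemiring K :=
  RingEquiv.ofRingHom (scaleHom q hq fun x => (h x).1)
    (scaleHom q⁻¹ (inv_pos.2 hq) fun x hx => (h _).2 (by rwa [mul_inv_cancel_left₀ hq.ne']))
    (by
      ext x
      induction x using NonnegSemiring.cases with
      | zero => rw [map_zero, map_zero]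
      | finite x =>
        refine congrArg finiteElt (Subtype.ext (Subtype.ext ?_))
        exact mul_inv_cancel_left₀ hq.ne' x.1.1)
    (by
      ext x
      induction x using NonnegSemiring.cases with
      | zero => rw [map_zero, map_zero]
      | finite x =>
        refine congrArg finiteElt (Subtype.ext (Subtype.ext ?_))
        exact inv_mul_cancel_left₀ hq.ne' x.1.1)

lemma scaleEquiv_finiteElt {q : ℚ} {hq : 0 < q} {h : ∀ x, x ∈ H ↔ q * x ∈ K}
    (x : {h : H // 0 ≤ h}) : scaleEquiv q hq h (finiteElt x) =
      finiteElt ⟨⟨q * x.1.1, (h _).1 x.1.2⟩, mul_nonneg hq.le x.2⟩ := rfl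

/-- Isomorphisms between semirings of nonnegative elements are multiplications by positive rational
numbers. -/
lemma exists_scale (hH : H ≠ ⊥) (e : NonnegSemiring H ≃+* NonnegSemiring K) :
    ∃ q : ℚ, 0 < q ∧ ∀ h, ∃ k, e (finiteElt h) = finiteElt k ∧ k.1.1 = q * h.1.1 := by
  have hfin : ∀ h, ∃ k, e (finiteElt h) = finiteElt k := fun h => by
    have h0 : e (finiteElt h) ≠ 0 := e.map_ne_zero_iff.2 (finiteElt_ne_zero h)
    generalize e (finiteElt h) = y at h0
    induction y using NonnegSemiring.cases with
    | zero => exact absurd rfl h0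
    | finite k => exact ⟨k, rfl⟩
  choose g hg using hfin
  have g_pos : ∀ h, (0 : ℚ) < h.1.1 → (0 : ℚ) < (g h).1.1 := fun h hh => by
    refine lt_of_le_of_ne (g h).2 fun h0 => hh.ne' ?_
    have : e (finiteElt h) = e (finiteElt 0) := by
      rw [hg, eq_zero_of_coe h0.symm, finiteElt_zero, finiteElt_zero, map_one]
    rw [finiteElt_injective (e.injective this)]
    rfl
  have g_nsmul : ∀ (n : ℕ) h, g (n • h) = n • g h := fun n h => finiteElt_injective (by
    rw [← hg, finiteElt_nsmul, finiteElt_nsmul, map_pow, hg])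
  obtain ⟨h₀, hh₀⟩ := exists_nonneg_of_ne_bot hH
  -- The ratio is read off at one positive `h₀`; every other positive element satisfies `m h = n
  -- h₀`, which forces the same ratio.
  refine ⟨(g h₀).1.1 / h₀.1.1, div_pos (g_pos _ hh₀) hh₀, fun h => ⟨g h, hg h, ?_⟩⟩
  rcases (show (0 : ℚ) ≤ h.1.1 from h.2).eq_or_lt with h0 | h0
  · have e0 : h = 0 := eq_zero_of_coe h0.symm
    have : g h = 0 := finiteElt_injective (by rw [← hg, e0, finiteElt_zero, map_one, finiteElt_zero])
    rw [this, ← h0, mul_zero]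
    rfl
  · obtain ⟨m, n, hmn⟩ := exists_nsmul_eq_nsmul h0 hh₀
    have h1 := congrArg (fun x : {h : H // 0 ≤ h} => x.1.1) hmn
    have h2 := congrArg (fun x : {h : H // 0 ≤ h} => (g x).1.1) hmn
    simp only [g_nsmul, nonneg_coe_nsmul] at h1 h2
    have hm : ((m : ℕ) : ℚ) ≠ 0 := by exact_mod_cast m.ne_zero
    have hh₀' := hh₀.ne'
    apply mul_left_cancel₀ hm
    rw [h2]
    field_simp
    linear_combination -(g h₀).1.1 * h1

/-- The scalings attached to `e` and to its inverse are inverse to each other, and negation extends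
them from nonnegative elements to the whole groups. -/
lemma exists_scale_subgroup (hH : H ≠ ⊥) (hK : K ≠ ⊥) (e : NonnegSemiring H ≃+* NonnegSemiring K) :
    ∃ q : ℚ, 0 < q ∧ (∀ h, ∃ k, e (finiteElt h) = finiteElt k ∧ k.1.1 = q * h.1.1) ∧
      ∀ x, x ∈ H ↔ q * x ∈ K := by
  obtain ⟨q, hq, h⟩ := exists_scale hH e
  obtain ⟨r, hr, k⟩ := exists_scale hK e.symm
  have mem_of : ∀ {A B : AddSubgroup ℚ} {s : ℚ} (f : {a : A // 0 ≤ a} → {b : B // 0 ≤ b}),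
      (∀ a, (f a).1.1 = s * a.1.1) → ∀ x ∈ A, s * x ∈ B := fun {A B s} f hf x hx => by
    rcases le_total 0 x with h0 | h0
    · have := (f ⟨⟨x, hx⟩, h0⟩).1.2
      rwa [hf] at this
    · have := (f ⟨⟨-x, A.neg_mem hx⟩, neg_nonneg.2 h0⟩).1.2
      rw [hf] at this
      rw [← neg_neg (s * x), ← mul_neg]
      exact B.neg_mem this
  choose f hf hf' using h
  choose g hg hg' using k
  obtain ⟨h₀, hh₀⟩ := exists_nonneg_of_ne_bot hH
  have hrq : r * q = 1 := by
    have e1 : g (f h₀) = h₀ := finiteElt_injective (by rw [← hg, ← hf, e.symm_apply_apply])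
    have e2 := hg' (f h₀)
    rw [e1, hf', ← mul_assoc] at e2
    exact (mul_right_cancel₀ hh₀.ne' (by rw [one_mul]; exact e2)).symm
  refine ⟨q, hq, fun h => ⟨f h, hf h, hf' h⟩, fun x => ⟨mem_of f hf' x, fun hx => ?_⟩⟩
  have := mem_of g hg' _ hx
  rwa [← mul_assoc, hrq, one_mul] at this

/-! ## Local morphisms to the unit interval -/

lemma expVal_top (r : ℝ) : expVal H r ⊤ = 0 := rfl

lemma expVal_coe (r : ℝ) (h : {h : H // 0 ≤ h}) : expVal H r (WithTop.some h) =
    if r = 0 then (if h = 0 then 1 else 0) else Real.exp (-(|r| * (h.1.1 : ℝ))) := rfl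

lemma expVal_zero (r : ℝ) : expVal H r (WithTop.some 0) = 1 := by
  rw [expVal_coe, if_pos rfl]
  split_ifs
  · rfl
  · change Real.exp (-(|r| * ((0 : ℚ) : ℝ))) = 1
    simp

lemma nonneg_add_eq_zero {h k : {h : H // 0 ≤ h}} : h + k = 0 ↔ h = 0 ∧ k = 0 := by
  refine ⟨fun e => ?_, fun ⟨e, e'⟩ => by rw [e, e', add_zero]⟩
  have e' : h.1.1 + k.1.1 = 0 := congrArg (fun x : {h : H // 0 ≤ h} => x.1.1) e
  have h1 : 0 ≤ h.1.1 := h.2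
  have h2 : 0 ≤ k.1.1 := k.2
  exact ⟨eq_zero_of_coe (by linarith), eq_zero_of_coe (by linarith)⟩

lemma expVal_add (r : ℝ) (x y : WithTop {h : H // 0 ≤ h}) :
    expVal H r (x + y) = expVal H r x * expVal H r y := by
  induction x with
  | top => rw [top_add, expVal_top, zero_mul]
  | coe h =>
    induction y with
    | top => rw [add_top, expVal_top, mul_zero]
    | coe k =>
      rw [← WithTop.coe_add, expVal_coe, expVal_coe, expVal_coe]
      by_cases hr : r = 0
      · simp only [if_pos hr, nonneg_add_eq_zero]
        by_cases h0 : h = 0 <;> by_cases k0 : k = 0 <;> simp [h0, k0]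
      · rw [if_neg hr, if_neg hr, if_neg hr, ← Real.exp_add]
        congr 1
        change -(|r| * ((h.1.1 + k.1.1 : ℚ) : ℝ)) = _
        push_cast
        ring

lemma expVal_nonneg (r : ℝ) (x : WithTop {h : H // 0 ≤ h}) : 0 ≤ expVal H r x := by
  induction x with
  | top => exact le_rfl
  | coe h =>
    rw [expVal_coe]
    split_ifs
    exacts [zero_le_one, le_rfl, (Real.exp_pos _).le]

lemma expVal_le_one (r : ℝ) (x : WithTop {h : H // 0 ≤ h}) : expVal H r x ≤ 1 := by
  induction x with
  | top => exact zero_le_one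
  | coe h =>
    rw [expVal_coe]
    split_ifs
    · exact le_rfl
    · exact zero_le_one
    · have : (0 : ℝ) ≤ h.1.1 := by exact_mod_cast h.2
      exact Real.exp_le_one_iff.2 (neg_nonpos.2 (mul_nonneg (abs_nonneg r) this))

/-- A larger element is a sum, so its value is a product with a further factor at most `1`.
Antitonicity is what turns `min` into `max` in `expHom`. -/
lemma expVal_antitone (r : ℝ) : Antitone (expVal H r) := by
  intro x y hxy
  induction y with
  | top => exact expVal_nonneg r x
  | coe k =>
    induction x with
    | top => exact absurd hxy (WithTop.not_top_le_coe k)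
    | coe h =>
      have hk : h ≤ k := WithTop.coe_le_coe.1 hxy
      have e : k = h + ⟨k.1 - h.1, sub_nonneg.2 hk⟩ :=
        Subtype.ext (add_sub_cancel h.1 k.1).symm
      rw [e, WithTop.coe_add, expVal_add]
      exact mul_le_of_le_one_right (expVal_nonneg r _) (expVal_le_one r _)

/-- This gives locality of `expHom`. It is also why `r = 0` has its own definition: `exp 0 = 1` at
positive elements would not be local. -/
lemma expVal_eq_one_iff (r : ℝ) {h : {h : H // 0 ≤ h}} :
    expVal H r (WithTop.some h) = 1 ↔ h = 0 := by
  refine ⟨fun e => ?_, fun e => e ▸ expVal_zero r⟩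
  rw [expVal_coe] at e
  split_ifs at e with h1 h2
  · exact h2
  · exact absurd e zero_ne_one
  · rw [Real.exp_eq_one_iff, neg_eq_zero, mul_eq_zero, abs_eq_zero] at e
    exact eq_zero_of_coe (by exact_mod_cast e.resolve_left h1)

/-- The real number underlying an element of the unit interval. -/
def UnitMax.toReal (x : UnitMax) : ℝ := (x.1.val : ℝ)

lemma UnitMax.toReal_injective : Function.Injective UnitMax.toReal := fun _ _ h =>
  Subtype.ext (NNReal.coe_injective h)

lemma UnitMax.toReal_mul (x y : UnitMax) : (x * y).toReal = x.toReal * y.toReal :=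
  NNReal.coe_mul x.1.val y.1.val

lemma UnitMax.toReal_add (x y : UnitMax) : (x + y).toReal = max x.toReal y.toReal :=
  NNReal.coe_max x.1.val y.1.val

lemma UnitMax.toReal_one : (1 : UnitMax).toReal = 1 := rfl

lemma UnitMax.toReal_nonneg (x : UnitMax) : 0 ≤ x.toReal := x.1.val.2

lemma UnitMax.toReal_pow (x : UnitMax) (n : ℕ) : (x ^ n).toReal = x.toReal ^ n := by
  induction n with
  | zero => rw [pow_zero, pow_zero, toReal_one]
  | succ n ih => rw [pow_succ, pow_succ, toReal_mul, ih]

lemma UnitMax.isUnit_iff_toReal {x : UnitMax} : IsUnit x ↔ x.toReal = 1 := by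
  rw [UnitMax.isUnit_iff]
  exact NNReal.coe_eq_one.symm

variable (H) in
/-- The morphism of semirings given by `expVal`. -/
def expHom (r : ℝ) : NonnegSemiring H →+* UnitMax where
  toFun x := ⟨RMax.of ⟨expVal H r (Tropical.untrop x), expVal_nonneg r _⟩, expVal_le_one r _⟩
  map_zero' := UnitMax.toReal_injective (expVal_top (H := H) r)
  map_one' := UnitMax.toReal_injective (expVal_zero (H := H) r)
  map_add' x y := UnitMax.toReal_injective (by
    rw [UnitMax.toReal_add]
    exact (expVal_antitone r).map_min)
  map_mul' x y := UnitMax.toReal_injective (by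
    rw [UnitMax.toReal_mul]
    exact expVal_add r _ _)

lemma expHom_toReal (r : ℝ) (x : NonnegSemiring H) :
    (expHom H r x).toReal = expVal H r (Tropical.untrop x) := rfl

lemma isLocalHom_expHom (r : ℝ) : IsLocalHom (expHom H r) where
  map_nonunit x hx := by
    rw [UnitMax.isUnit_iff_toReal, expHom_toReal] at hx
    induction x using NonnegSemiring.cases with
    | zero => exact absurd hx zero_ne_one
    | finite h =>
      rw [(expVal_eq_one_iff r).1 hx, finiteElt_zero]
      exact isUnit_one

/-- Every local morphism of semirings to the unit interval is given by `expVal`. -/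
lemma exists_eq_expHom (hH : H ≠ ⊥) (f : NonnegSemiring H →+* UnitMax) (hf : IsLocalHom f) :
    ∃ r, f = expHom H r := by
  obtain ⟨h₀, hh₀⟩ := exists_nonneg_of_ne_bot hH
  have hlt : (f (finiteElt h₀)).toReal ≠ 1 := fun h1 => by
    have := isUnit_iff_eq_one.1 (hf.map_nonunit _ (UnitMax.isUnit_iff_toReal.2 h1))
    rw [finiteElt_injective (this.trans finiteElt_zero.symm)] at hh₀
    exact lt_irrefl _ hh₀
  have hle : (f (finiteElt h₀)).toReal ≤ 1 := (f (finiteElt h₀)).2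
  -- The value at `h₀` lies in `[0, 1)`: take `r = 0` if it vanishes, and otherwise its logarithm
  -- divided by `h₀`, whose sign is irrelevant.
  obtain ⟨r, hr⟩ : ∃ r, (f (finiteElt h₀)).toReal = (expHom H r (finiteElt h₀)).toReal := by
    have hh0 : h₀ ≠ 0 := fun h0 => hh₀.ne' (by rw [h0]; rfl)
    have hpos : (0 : ℝ) < h₀.1.1 := by exact_mod_cast hh₀
    rcases (UnitMax.toReal_nonneg (f (finiteElt h₀))).eq_or_lt with h0 | h0
    · refine ⟨0, ?_⟩
      rw [← h0]
      change 0 = expVal H 0 (WithTop.some h₀)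
      rw [expVal_coe, if_pos rfl, if_neg hh0]
    · have hlog := Real.log_neg h0 (lt_of_le_of_ne hle hlt)
      refine ⟨Real.log (f (finiteElt h₀)).toReal / h₀.1.1, ?_⟩
      change _ = expVal H _ (WithTop.some h₀)
      rw [expVal_coe, if_neg (div_ne_zero hlog.ne hpos.ne'), abs_div, abs_of_neg hlog,
        abs_of_pos hpos, div_mul_cancel₀ _ hpos.ne', neg_neg, Real.exp_log h0]
  refine ⟨r, RingHom.ext fun x => ?_⟩
  induction x using NonnegSemiring.cases with
  | zero => rw [map_zero, map_zero]
  | finite h =>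
    rcases (show (0 : ℚ) ≤ h.1.1 from h.2).eq_or_lt with h0 | h0
    · rw [eq_zero_of_coe h0.symm, finiteElt_zero, map_one, map_one]
    · obtain ⟨m, n, hmn⟩ := exists_nsmul_eq_nsmul h0 hh₀
      -- From `m h = n h₀`, the value at `h` is the nonnegative `m`-th root of the `n`-th power of
      -- the value at `h₀`.
      have key : ∀ g : NonnegSemiring H →+* UnitMax,
          (g (finiteElt h)).toReal ^ (m : ℕ) = (g (finiteElt h₀)).toReal ^ (n : ℕ) := fun g => by
        rw [← UnitMax.toReal_pow, ← UnitMax.toReal_pow, ← map_pow, ← map_pow, ← finiteElt_nsmul,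
          ← finiteElt_nsmul, hmn]
      apply UnitMax.toReal_injective
      rw [← pow_left_inj₀ (UnitMax.toReal_nonneg _) (UnitMax.toReal_nonneg _) m.ne_zero, key, key,
        hr]

lemma expVal_scale {r s : ℝ} {q : ℚ} (hq : 0 < q) (hrs : |r| = q * |s|)
    {h : {h : H // 0 ≤ h}} {k : {k : K // 0 ≤ k}} (hk : k.1.1 = q * h.1.1) :
    expVal H r (WithTop.some h) = expVal K s (WithTop.some k) := by
  have hq' : (q : ℝ) ≠ 0 := by exact_mod_cast hq.ne'
  have h0 : r = 0 ↔ s = 0 := by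
    rw [← abs_eq_zero, hrs, mul_eq_zero, or_iff_right hq', abs_eq_zero]
  have h1 : h = 0 ↔ k = 0 := by
    refine ⟨fun e => eq_zero_of_coe (by rw [hk, e]; exact mul_zero q),
      fun e => eq_zero_of_coe ?_⟩
    rw [e] at hk
    exact (mul_eq_zero.1 hk.symm).resolve_left hq.ne'
  rw [expVal_coe, expVal_coe]
  simp only [h0, h1]
  split_ifs
  · rfl
  · rfl
  · rw [hk, hrs]
    push_cast
    ring_nf

/-- A single positive element suffices: the value there is `0` exactly when the parameter is `0`,
and otherwise its logarithm gives the absolute value. -/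
lemma abs_eq_of_expVal_eq {r s : ℝ} {q : ℚ} (hq : 0 < q)
    {h : {h : H // 0 ≤ h}} (hh : (0 : ℚ) < h.1.1) {k : {k : K // 0 ≤ k}} (hk : k.1.1 = q * h.1.1)
    (he : expVal H r (WithTop.some h) = expVal K s (WithTop.some k)) : |r| = q * |s| := by
  have hh0 : h ≠ 0 := fun h0 => hh.ne' (by rw [h0]; rfl)
  have hk0 : k ≠ 0 := fun h0 => (mul_pos hq hh).ne' (by rw [← hk, h0]; rfl)
  have hpos : (0 : ℝ) < h.1.1 := by exact_mod_cast hh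
  rw [expVal_coe, expVal_coe, if_neg hh0, if_neg hk0] at he
  split_ifs at he with h1 h2 h2
  · rw [h1, h2]; simp
  · exact absurd he (Real.exp_pos _).ne
  · exact absurd he (Real.exp_pos _).ne'
  · rw [Real.exp_eq_exp, hk, neg_inj] at he
    push_cast at he
    apply mul_right_cancel₀ hpos.ne'
    rw [he]
    ring

end Nonneg

/-! ## The correspondence between points and adèles -/

/-- A point over the unit interval has the given subgroup of `ℚ` and real number as parameters. -/
def HasParameters (P : Point UnitMax) (H : AddSubgroup ℚ) (r : ℝ) : Prop :=
  ∃ e : NonnegSemiring H ≃+* LocalSemiring P.base, ∀ x, P.hom (e x) = expHom H r x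

lemma corresponds_iff {P : Point UnitMax} {a : Adele} :
    Corresponds P a ↔ HasParameters P (ratGroup a.2) (arch a) := by
  refine exists_congr fun e => ⟨fun h x => UnitMax.toReal_injective ?_, fun h x => ?_⟩
  · exact h (Tropical.untrop x)
  · exact congrArg UnitMax.toReal (h (Tropical.trop x))

lemma HasParameters.scale {P : Point UnitMax} {H K : AddSubgroup ℚ} {r s : ℝ}
    (h : HasParameters P H r) {q : ℚ} (hq : 0 < q) (hHK : ∀ x, x ∈ H ↔ q * x ∈ K)
    (hrs : |r| = q * |s|) : HasParameters P K s := by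
  obtain ⟨e, he⟩ := h
  refine ⟨(scaleEquiv q hq hHK).symm.trans e, fun x => ?_⟩
  obtain ⟨y, rfl⟩ := (scaleEquiv q hq hHK).surjective x
  rw [RingEquiv.trans_apply, RingEquiv.symm_apply_apply, he]
  induction y using NonnegSemiring.cases with
  | zero => rw [map_zero, map_zero, map_zero]
  | finite y =>
    rw [scaleEquiv_finiteElt]
    exact UnitMax.toReal_injective (expVal_scale hq hrs rfl)

lemma HasParameters.exists_scale {P : Point UnitMax} {H K : AddSubgroup ℚ} {r s : ℝ}
    (hH : H ≠ ⊥) (hK : K ≠ ⊥) (h : HasParameters P H r) (k : HasParameters P K s) :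
    ∃ q : ℚ, 0 < q ∧ (∀ x, x ∈ H ↔ q * x ∈ K) ∧ |r| = q * |s| := by
  obtain ⟨e, he⟩ := h
  obtain ⟨e', he'⟩ := k
  obtain ⟨q, hq, hfin, hmem⟩ := exists_scale_subgroup hH hK (e.trans e'.symm)
  obtain ⟨h₀, hh₀⟩ := exists_nonneg_of_ne_bot hH
  obtain ⟨k₀, hk, hk'⟩ := hfin h₀
  refine ⟨q, hq, hmem, abs_eq_of_expVal_eq hq hh₀ hk' ?_⟩
  have : e (finiteElt h₀) = e' (finiteElt k₀) := by
    rw [← hk, RingEquiv.trans_apply, RingEquiv.apply_symm_apply]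
  exact congrArg UnitMax.toReal ((he _).symm.trans ((congrArg P.hom this).trans (he' _)))

/-- Equal parameters identify the two stalks compatibly with the maps to `[0, 1]`, and an
isomorphism of stalks always lifts to the points. -/
lemma HasParameters.iso {P Q : Point UnitMax} {H : AddSubgroup ℚ} {r : ℝ}
    (h : HasParameters P H r) (k : HasParameters Q H r) : P.Iso Q := by
  obtain ⟨e, he⟩ := h
  obtain ⟨e', he'⟩ := k
  obtain ⟨α, hα⟩ := exists_iso_of_stalkEquiv (e.symm.trans e')
  refine ⟨α, fun s => ?_⟩
  rw [hα, RingEquiv.trans_apply, he', ← he, RingEquiv.apply_symm_apply]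

lemma HasParameters.of_iso {P Q : Point UnitMax} {H : AddSubgroup ℚ} {r : ℝ}
    (h : HasParameters P H r) (hPQ : P.Iso Q) : HasParameters Q H r := by
  obtain ⟨e, he⟩ := h
  obtain ⟨α, hα⟩ := hPQ
  exact ⟨e.trans (stalkEquiv α), fun x => (hα (e x)).trans (he x)⟩

lemma Point.exists_hasParameters (P : Point UnitMax) : ∃ H r, H ≠ ⊥ ∧ HasParameters P H r := by
  obtain ⟨H, ⟨c⟩⟩ := exists_fiberCoord P.base
  obtain ⟨e⟩ := c.nonempty_ringEquiv
  have hloc : IsLocalHom (P.hom.comp e.toRingHom) := ⟨fun x hx =>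
    (MulEquiv.isUnit_map e.toMulEquiv).1 (P.isLocal.map_nonunit (e x) hx)⟩
  obtain ⟨r, hr⟩ := exists_eq_expHom c.ne_bot _ hloc
  exact ⟨H, r, c.ne_bot, e, fun x => congrArg (fun f : NonnegSemiring H →+* UnitMax => f x) hr⟩

lemma exists_point_hasParameters {H : AddSubgroup ℚ} (hH : H ≠ ⊥) (r : ℝ) :
    ∃ P, HasParameters P H r := by
  obtain ⟨e⟩ := (subgroupPointCoord H hH).nonempty_ringEquiv
  refine ⟨⟨subgroupPoint H hH, (expHom H r).comp e.symm.toRingHom, ⟨fun x hx => ?_⟩⟩, e, fun x => ?_⟩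
  · exact (MulEquiv.isUnit_map e.symm.toMulEquiv).1
      ((isLocalHom_expHom r).map_nonunit (e.symm x) hx)
  · exact congrArg (expHom H r) (e.symm_apply_apply x)

lemma exists_adele {H : AddSubgroup ℚ} (hH : H ≠ ⊥) (r : ℝ) :
    ∃ a : Adele, ratGroup a.2 = H ∧ arch a = r := by
  obtain ⟨b, hb⟩ := exists_ratGroup_eq H hH
  exact ⟨(archEquiv.symm r, b), hb, archEquiv.apply_symm_apply r⟩

lemma exists_corresponds (P : Point UnitMax) : ∃ a, Corresponds P a := by
  obtain ⟨H, r, hH, h⟩ := P.exists_hasParameters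
  obtain ⟨a, rfl, rfl⟩ := exists_adele hH r
  exact ⟨a, corresponds_iff.2 h⟩

lemma ratGroup_mul_principal {q : ℚ} (hq : q ≠ 0) (a : FiniteAdeleRing ℤ ℚ) {u : Adeleˣ}
    (hu : u ∈ ZHatUnits) (x : ℚ) :
    x ∈ ratGroup a ↔ |q|⁻¹ * x ∈ ratGroup (algebraMap ℚ _ q * a * u.1.2) := by
  rw [ratGroup_mul_unit _ hu, mem_ratGroup_algebraMap_mul]
  rcases abs_choice q with h | h <;> rw [h]
  · rw [mul_right_comm, inv_mul_cancel₀ hq, one_mul]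
  · rw [inv_neg, neg_mul, neg_mul, mul_right_comm, inv_mul_cancel₀ hq, one_mul, neg_mem_iff]

lemma Corresponds.of_equiv {P : Point UnitMax} {a b : Adele} (h : Corresponds P a) (hab : a ≈ b) :
    Corresponds P b := by
  obtain ⟨_, ⟨q, rfl⟩, u, hu, rfl⟩ := hab
  have hq : (0 : ℚ) < |q.1|⁻¹ := inv_pos.2 (abs_pos.2 q.ne_zero)
  refine corresponds_iff.2 ((corresponds_iff.1 h).scale hq
    (ratGroup_mul_principal q.ne_zero a.2 hu) ?_)
  have e : arch ((principal q).1 * a * u.1) = q.1 * arch a := by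
    rw [arch_mul, arch_mul, principal_val, arch_algebraMap, arch_of_mem_ZHatUnits hu, mul_one]
  have hq' : |(q.1 : ℝ)| ≠ 0 := abs_ne_zero.2 (by exact_mod_cast q.ne_zero)
  refine Eq.trans ?_ (congrArg (fun r : ℝ => ((|q.1|⁻¹ : ℚ) : ℝ) * |r|) e.symm)
  rw [abs_mul]
  push_cast
  rw [inv_mul_cancel_left₀ hq']

lemma Corresponds.equiv {P : Point UnitMax} {a b : Adele} (h : Corresponds P a)
    (k : Corresponds P b) : a ≈ b := by
  obtain ⟨q, hq, hmem, habs⟩ := HasParameters.exists_scale (ratGroup_ne_bot _) (ratGroup_ne_bot _)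
    (corresponds_iff.1 h) (corresponds_iff.1 k)
  have heq : ratGroup (algebraMap ℚ _ q⁻¹ * a.2) = ratGroup b.2 := by
    ext x
    rw [mem_ratGroup_algebraMap_mul, hmem, mul_comm x, mul_inv_cancel_left₀ hq.ne']
  obtain ⟨u, hu, -, hb⟩ := exists_unit_of_ratGroup_eq heq
  have key : ∀ (g : ℚˣ) (w : Adeleˣ), w ∈ ZHatUnits → arch b = g.1 * arch a →
      b.2 = algebraMap ℚ _ g.1 * a.2 * w.1.2 → a ≈ b := fun g w hw h1 h2 => by
    refine ⟨principal g, principal_mem g, w, hw, adele_ext ?_ h2⟩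
    rw [arch_mul, arch_mul, principal_val, arch_algebraMap, arch_of_mem_ZHatUnits hw, mul_one, h1]
  have hq' : (0 : ℝ) < q := by exact_mod_cast hq
  have habs' : |arch b| = |(q : ℝ)⁻¹ * arch a| := by
    rw [abs_mul, habs, abs_inv, abs_of_pos hq', inv_mul_cancel_left₀ hq'.ne']
  -- Only `|arch b| = q⁻¹ |arch a|` is known. If the signs differ, `-q⁻¹` replaces `q⁻¹`, and the
  -- unit of `ZHat` changes sign so that the finite part stays the same.
  rcases abs_eq_abs.1 habs' with e | e
  · refine key (Units.mk0 q hq.ne')⁻¹ u hu (by rw [e]; simp) ?_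
    rw [hb, Units.val_inv_eq_inv_val, Units.val_mk0]
  · obtain ⟨w, hw, hwu⟩ := exists_neg_unit hu
    refine key (-(Units.mk0 q hq.ne')⁻¹) w hw (by rw [e]; simp) ?_
    rw [hb, hwu, Units.val_neg, Units.val_inv_eq_inv_val, Units.val_mk0, map_neg, neg_mul,
      neg_mul_neg]

lemma expVal_mul_rpow {H : AddSubgroup ℚ} (t : {t : ℝ // 0 < t}) (r : ℝ)
    (x : WithTop {h : H // 0 ≤ h}) : expVal H (t.1 * r) x = expVal H r x ^ t.1 := by
  have ht : t.1 ≠ 0 := t.2.ne'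
  induction x with
  | top => rw [expVal_top, expVal_top, Real.zero_rpow ht]
  | coe h =>
    rw [expVal_coe, expVal_coe]
    simp only [mul_eq_zero, ht, false_or]
    split_ifs
    · rw [Real.one_rpow]
    · rw [Real.zero_rpow ht]
    · rw [← Real.exp_mul, abs_mul, abs_of_pos t.2]
      congr 1
      ring

lemma UnitMax.toReal_Fr (t : {t : ℝ // 0 < t}) (x : UnitMax) :
    (UnitMax.Fr t x).toReal = x.toReal ^ t.1 := NNReal.coe_rpow x.1.val t.1

lemma Corresponds.comp_Fr {P : Point UnitMax} {a : Adele} (h : Corresponds P a)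
    (t : {t : ℝ // 0 < t}) : Corresponds (P.comp (UnitMax.Fr t)) ((archIdele t).1 * a) := by
  have e2 : ((archIdele t).1 * a).2 = a.2 := one_mul a.2
  rw [corresponds_iff, e2, arch_mul, arch_archIdele]
  obtain ⟨e, he⟩ := corresponds_iff.1 h
  refine ⟨e, fun x => UnitMax.toReal_injective ?_⟩
  change (UnitMax.Fr t (P.hom (e x))).toReal = _
  rw [UnitMax.toReal_Fr, he, expHom_toReal, expHom_toReal, expVal_mul_rpow]

/-- The class of adèles that correspond to a point. -/
def adeleClass : Points UnitMax → DoubleQuotient :=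
  Quotient.lift (fun P => Quotient.mk _ (exists_corresponds P).choose) fun P Q hPQ => by
    have hP := (exists_corresponds P).choose_spec
    have hQ := (exists_corresponds Q).choose_spec
    exact Quotient.sound
      ((corresponds_iff.2 ((corresponds_iff.1 hP).of_iso hPQ)).equiv hQ)

lemma adeleClass_eq_iff (P : Point UnitMax) (a : Adele) :
    adeleClass (Quotient.mk _ P) = Quotient.mk _ a ↔ Corresponds P a := by
  have hP := (exists_corresponds P).choose_spec
  exact ⟨fun h => hP.of_equiv (Quotient.exact h), fun h => Quotient.sound (hP.equiv h)⟩

lemma adeleClass_bijective : Function.Bijective adeleClass := by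
  constructor
  · intro x y hxy
    obtain ⟨P, rfl⟩ := Quotient.exists_rep x
    obtain ⟨Q, rfl⟩ := Quotient.exists_rep y
    obtain ⟨a, ha⟩ := exists_corresponds P
    have hQ := (adeleClass_eq_iff Q a).1 (hxy.symm.trans ((adeleClass_eq_iff P a).2 ha))
    exact Quotient.sound ((corresponds_iff.1 ha).iso (corresponds_iff.1 hQ))
  · intro y
    obtain ⟨a, rfl⟩ := Quotient.exists_rep y
    obtain ⟨P, hP⟩ := exists_point_hasParameters (ratGroup_ne_bot a.2) (arch a)
    exact ⟨Quotient.mk _ P, (adeleClass_eq_iff P a).2 (corresponds_iff.2 hP)⟩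

lemma adeleClass_Fr_smul (t : {t : ℝ // 0 < t}) (x : Points UnitMax) :
    adeleClass (UnitMax.Fr t • x) = archClass t • adeleClass x := by
  obtain ⟨P, rfl⟩ := Quotient.exists_rep x
  obtain ⟨a, ha⟩ := exists_corresponds P
  rw [(adeleClass_eq_iff P a).2 ha]
  exact (adeleClass_eq_iff _ _).2 (ha.comp_Fr t)

end ArithSite

end

theorem theorem3 :
    ∃ (Φ : ArithSite.Points ArithSite.UnitMax ≃ ArithSite.DoubleQuotient)
      (θ : {t : ℝ // 0 < t} ≃* ArithSite.IdeleClassModZHat),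
      (∀ (P : ArithSite.Point ArithSite.UnitMax) (a : ArithSite.Adele),
        Φ (Quotient.mk _ P) = Quotient.mk _ a ↔ ArithSite.Corresponds P a) ∧
      (∀ t : {t : ℝ // 0 < t}, θ t = ArithSite.archClass t) ∧
      (∀ (t : {t : ℝ // 0 < t}) (x : ArithSite.Points ArithSite.UnitMax),
        Φ (ArithSite.UnitMax.Fr t • x) = θ t • Φ x) :=
  ⟨Equiv.ofBijective _ ArithSite.adeleClass_bijective, ArithSite.archClassEquiv,
    ArithSite.adeleClass_eq_iff, fun _ => rfl, ArithSite.adeleClass_Fr_smul⟩
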